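/- **Theorem (Stability of Multiplicities, integral case).** Write $\mathbb N_+=\{1,2,\dots\}$, $\mathbb N_-=\{-1,-2,\dots\}$. Let $G$ be a real form of $SL(2,\mathbb C)$, i.e. a closed subgroup whose Lie algebra $\mathfrak g$ satisfies $\mathfrak{sl}(2,\mathbb C)=\mathfrak g\oplus i\mathfrak g$, let $\{H,X,Y\}\subset\mathfrak{sl}(2,\mathbb C)$ be an $\mathfrak{sl}_2$-triple ($[H,X]=2X$, $[H,Y]=-2Y$, $[X,Y]=H\neq 0$), and let $G'\subset G$ be a connected closed subgroup whose complexified Lie algebra is $\mathbb C H$. For $\nu\in\mathbb Z$ let $\mathbb C_\nu$ be the character of $G'$ with differential $tH\mapsto\nu t$. Let $\mathcal M(G)$ be the category of admissible smooth Fréchet representations of $G$ of finite length and moderate growth. For $\pi\in\mathcal M(G)$, the multiplicity $[\pi:\mathbb C_\nu]$ is the dimension of $\operatorname{Hom}_{G'}(\pi|_{G'},\mathbb C_\nu)$, the space of continuous $G'$-homomorphisms. A representation has infinitesimal character $\mu\in\mathbb C$ if the Casimir element $\Omega=H^2+2(XY+YX)$ (which generates the centre of $U(\mathfrak{sl}(2,\mathbb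 C))$) acts by the scalar $\mu^2-1$, and $P_\mu(V)=\bigcup_k\operatorname{Ker}(\Omega-(\mu^2-1))^k$ is the corresponding primary component. Let $\xi\in\mathbb C\setminus\{0\}$ and set $\Lambda(\xi)=\xi+\mathbb Z$ if $\xi\notin\mathbb Z$, $\Lambda(\xi)=\mathbb N_+$ if $\xi\in\mathbb N_+$, and $\Lambda(\xi)=\mathbb N_-$ if $\xi\in\mathbb N_-$. Let $\Pi\in\mathcal M(G)$ have infinitesimal character $\xi$, and let $\{\Pi_\lambda:\lambda\in\Lambda(\xi)\}\subset\mathcal M(G)$ be a reduced coherent family through $\Pi$, that is: $\Pi_\xi=\Pi$; $\Pi_\lambda$ has infinitesimal character $\lambda$; and, for $\delta\in\{1,-1\}$, whenever $\lambda,\lambda+\delta\in\Lambda(\xi)$, $$P_{\lambda+\delta}(\Pi_\lambda\otimes\mathbb C^2)\simeq\Pi_{\lambda+\delta},\qquad P_\lambda(\Pi_{\lambda+\delta}\otimes\mathbb C^2)\simeq\Pi_\lambda .$$ Put $\Xi=\Lambda(\xi)\times\mathbb Z$. (1) Suppose $\xi\notin\mathbb Z$. Then the multiplicity $[\Pi_\lambda:\mathbb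 C_\nu]$, $(\lambda,\nu)\in\Xi$, depends only on the parity of $\lambda-\xi-\nu\in\mathbb Z$. (2) Suppose $\xi\in\mathbb N_+$, so that $\Xi=\mathbb N_+\times\mathbb Z$. Then $\Xi$ is the disjoint union of $\Xi_{\rm even}$ ($\lambda\equiv\nu \bmod 2$) and $\Xi_{\rm odd}$ ($\lambda\equiv\nu+1\bmod 2$), and $\Xi_{\rm odd}$ is the disjoint union of its parts $\Xi_{\rm odd}^{\uparrow}$, $\Xi_{\rm odd}^{\rightarrow}$, $\Xi_{\rm odd}^{\downarrow}$ given by $\nu\ge\lambda+1$, $\lambda\ge|\nu|+1$, and $\nu\le-\lambda-1$, respectively. The multiplicity $[\Pi_\lambda:\mathbb C_\nu]$ is constant on each of the four regions $\Xi_{\rm even}$, $\Xi_{\rm odd}^{\uparrow}$, $\Xi_{\rm odd}^{\rightarrow}$, $\Xi_{\rm odd}^{\downarrow}$. -/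

import Mathlib

open Filter Topology

noncomputable section

namespace SL2Branching

universe u

/-! ### The Lie algebra of a closed subgroup of `SL(2, ℂ)` -/

/-- The algebra of complex `2 × 2` matrices. -/
abbrev M2 : Type := Matrix (Fin 2) (Fin 2) ℂ

/-- The group `SL(2, ℂ)`. -/
abbrev SL2C : Type := Matrix.SpecialLinearGroup (Fin 2) ℂ

theorem norm_pow_sub_pow_le {A : Type*} [NormedRing A] [NormOneClass A] (a b : A) (R : ℝ)
    (hR : 1 ≤ R) (ha : ‖a‖ ≤ R) (hb : ‖b‖ ≤ R) (k : ℕ) :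
    ‖a ^ k - b ^ k‖ ≤ k * ‖a - b‖ * R ^ k := by
  induction k with
  | zero => simp
  | succ k ih =>
    have h1 : a ^ (k + 1) - b ^ (k + 1) = a ^ k * (a - b) + (a ^ k - b ^ k) * b := by
      rw [pow_succ, pow_succ, mul_sub, sub_mul]; abel
    have h2 : ‖a ^ k‖ ≤ R ^ k := (norm_pow_le a k).trans (pow_le_pow_left₀ (norm_nonneg _) ha k)
    have h3 : R ^ k ≤ R ^ (k + 1) := pow_le_pow_right₀ hR (Nat.le_succ k)
    rw [h1]
    calc _ ≤ ‖a ^ k‖ * ‖a - b‖ + ‖a ^ k - b ^ k‖ * ‖b‖ :=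
          (norm_add_le _ _).trans (add_le_add (norm_mul_le _ _) (norm_mul_le _ _))
      _ ≤ R ^ (k + 1) * ‖a - b‖ + (k * ‖a - b‖ * R ^ k) * R := by
          gcongr
          exact h2.trans h3
      _ = _ := by push_cast; ring

/-- Lie product formula. -/
theorem tendsto_exp_mul_exp_pow {A : Type*} [NormedRing A] [NormedAlgebra ℝ A] [NormOneClass A]
    [CompleteSpace A] (X Y : A) :
    Tendsto (fun n : ℕ => (NormedSpace.exp (((n : ℝ) + 1)⁻¹ • X) *
      NormedSpace.exp (((n : ℝ) + 1)⁻¹ • Y)) ^ (n + 1)) atTop (𝓝 (NormedSpace.exp (X + Y))) := by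
  let : NormedAlgebra ℚ A := NormedAlgebra.restrictScalars ℚ ℝ A
  set f : ℝ → A := fun s => NormedSpace.exp (s • X) * NormedSpace.exp (s • Y)
  set g : ℝ → A := fun s => NormedSpace.exp (s • (X + Y))
  have e (Z : A) : HasDerivAt (fun s : ℝ => NormedSpace.exp (s • Z)) Z 0 := by
    simpa using hasDerivAt_exp_smul_const (𝕂 := ℝ) Z 0
  have hf : HasDerivAt f (X + Y) 0 := by
    have h := (e X).mul (e Y)
    simp only [zero_smul, NormedSpace.exp_zero, mul_one, one_mul] at h
    exact h
  have hg : HasDerivAt g (X + Y) 0 := e _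
  have f0 : f 0 = 1 := by simp [f]
  have g0 : g 0 = 1 := by simp [g]
  have hs : Tendsto (fun n : ℕ => ((n : ℝ) + 1)⁻¹) atTop (𝓝 0) := by
    simpa using tendsto_one_div_add_atTop_nhds_zero_nat (𝕜 := ℝ)
  obtain ⟨C, hC⟩ := (hf.differentiableAt.isBigO_sub.comp_tendsto hs).bound
  obtain ⟨D, hD⟩ := (hg.differentiableAt.isBigO_sub.comp_tendsto hs).bound
  have ho : (fun s => f s - g s) =o[𝓝 0] (fun s => s) := by
    have := (hf.sub hg).isLittleO
    simpa [f0, g0] using this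
  have ho := ho.comp_tendsto hs
  have hgn : ∀ n : ℕ, g (((n : ℝ) + 1)⁻¹) ^ (n + 1) = NormedSpace.exp (X + Y) := by
    intro n
    simp only [g]
    rw [← NormedSpace.exp_nsmul, ← Nat.cast_smul_eq_nsmul ℝ, smul_smul]
    push_cast
    rw [mul_inv_cancel₀ (by positivity), one_smul]
  rw [← tendsto_sub_nhds_zero_iff]
  set M := max (max C D) 0
  have hM : 0 ≤ M := le_max_right _ _
  have key : Tendsto (fun n : ℕ => Real.exp M * (((n : ℝ) + 1) *
      ‖f (((n : ℝ) + 1)⁻¹) - g (((n : ℝ) + 1)⁻¹)‖)) atTop (𝓝 0) := by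
    have := ho.norm_left.tendsto_div_nhds_zero
    simpa [div_eq_mul_inv, mul_comm] using this.const_mul (Real.exp M)
  refine squeeze_zero_norm' ?_ key
  filter_upwards [hC, hD] with n h1 h2
  have hpos : (0 : ℝ) < (n : ℝ) + 1 := by positivity
  simp only [Function.comp, sub_zero, f0, g0, norm_inv, Real.norm_of_nonneg hpos.le] at h1 h2
  have bd : ∀ a : A, ‖a - 1‖ ≤ M * ((n : ℝ) + 1)⁻¹ → ‖a‖ ≤ 1 + M * ((n : ℝ) + 1)⁻¹ := by
    intro a h
    calc ‖a‖ = ‖1 + (a - 1)‖ := by congr 1; abel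
      _ ≤ _ := (norm_add_le _ _).trans (by simpa using h)
  have hi : (0 : ℝ) ≤ ((n : ℝ) + 1)⁻¹ := by positivity
  have b1 := bd _ (h1.trans (mul_le_mul_of_nonneg_right
    ((le_max_left C D).trans (le_max_left _ _)) hi))
  have b2 := bd _ (h2.trans (mul_le_mul_of_nonneg_right
    ((le_max_right C D).trans (le_max_left _ _)) hi))
  rw [← hgn n]
  refine (norm_pow_sub_pow_le _ _ _ (by nlinarith [mul_nonneg hM hi]) b1 b2 (n + 1)).trans ?_
  have hexp : (1 + M * ((n : ℝ) + 1)⁻¹) ^ (n + 1) ≤ Real.exp M := by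
    have h := Real.add_one_le_exp (M * ((n : ℝ) + 1)⁻¹)
    calc _ ≤ Real.exp (M * ((n : ℝ) + 1)⁻¹) ^ (n + 1) :=
          pow_le_pow_left₀ (by positivity) (by linarith) _
      _ = Real.exp M := by
          rw [← Real.exp_nat_mul]; congr 1; push_cast; field_simp
  rw [mul_comm (Real.exp M)]
  push_cast
  gcongr

open scoped Matrix.Norms.Operator in
theorem tendsto_matrix_exp (X Y : M2) :
    Tendsto (fun n : ℕ => (NormedSpace.exp (((n : ℝ) + 1)⁻¹ • X) *
      NormedSpace.exp (((n : ℝ) + 1)⁻¹ • Y)) ^ (n + 1)) atTop (𝓝 (NormedSpace.exp (X + Y))) :=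
  tendsto_exp_mul_exp_pow X Y

/-- The (real) Lie algebra `{X | exp (t X) ∈ G for all real t}` of a closed subgroup `G` of
`SL(2, ℂ)`. -/
def lieAlg (G : ClosedSubgroup SL2C) : Submodule ℝ M2 where
  carrier := {X | ∀ t : ℝ, ∃ g ∈ G.toSubgroup, (g : M2) = NormedSpace.exp (t • X)}
  zero_mem' := fun t => ⟨1, one_mem _, by simp⟩
  smul_mem' := fun c X hX t => by
    obtain ⟨g, hg, h⟩ := hX (t * c)
    exact ⟨g, hg, by rw [h, smul_smul]⟩
  add_mem' := fun {X Y} hX hY t => by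
    have hcl : IsClosed ((fun g : SL2C => (g : M2)) '' (G.toSubgroup : Set SL2C)) :=
      Matrix.SpecialLinearGroup.isClosedEmbedding_val.isClosedMap _ G.isClosed'
    have := hcl.mem_of_tendsto (tendsto_matrix_exp (t • X) (t • Y)) (Eventually.of_forall fun n => by
      obtain ⟨g, hg, h⟩ := hX (((n : ℝ) + 1)⁻¹ * t)
      obtain ⟨k, hk, h'⟩ := hY (((n : ℝ) + 1)⁻¹ * t)
      refine ⟨(g * k) ^ (n + 1), pow_mem (mul_mem hg hk) _, ?_⟩
      simp [h, h', smul_smul])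
    obtain ⟨g, hg, h⟩ := this
    exact ⟨g, hg, by rw [smul_add]; exact h⟩

theorem exists_coe_eq_exp (G : ClosedSubgroup SL2C) (X : lieAlg G) :
    ∃ g : G.toSubgroup, ((g : SL2C) : M2) = NormedSpace.exp (X : M2) := by
  obtain ⟨g, hg, h⟩ := X.2 1
  exact ⟨⟨g, hg⟩, by rw [h, one_smul]⟩

/-- The exponential map from the Lie algebra of `G` to `G`. -/
def expMap (G : ClosedSubgroup SL2C) (X : lieAlg G) : G.toSubgroup :=
  (exists_coe_eq_exp G X).choose

theorem coe_expMap (G : ClosedSubgroup SL2C) (X : lieAlg G) :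
    ((expMap G X : SL2C) : M2) = NormedSpace.exp (X : M2) :=
  (exists_coe_eq_exp G X).choose_spec

/-- A real form of `SL(2, ℂ)`: a closed subgroup `G` whose Lie algebra `𝔤` is a real form of
`𝔰𝔩(2, ℂ)`, that is, `𝔰𝔩(2, ℂ) = 𝔤 ⊕ i 𝔤`. -/
structure RealForm extends ClosedSubgroup SL2C where
  existsUnique_add_I_smul : ∀ Z : M2, Z.trace = 0 →
    ∃! p : lieAlg toClosedSubgroup × lieAlg toClosedSubgroup,
      Z = (p.1 : M2) + Complex.I • (p.2 : M2)

/-- The Lie algebra of a real form. -/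
abbrev RealForm.lie (G : RealForm) : Submodule ℝ M2 := lieAlg G.toClosedSubgroup

/-- The underlying group of a real form. -/
abbrev RealForm.Pt (G : RealForm) : Type := G.toSubgroup

/-! ### The action of the complexified Lie algebra and the Casimir element -/

section Action

variable {V : Type u} [AddCommGroup V] [Module ℂ V] [TopologicalSpace V]

/-- The derivative at `t = 0` of `exp (t X) v`, for an action `a` of `G` on `V` and `X ∈ 𝔤`. -/
def lieDeriv (G : RealForm) (a : G.Pt → V → V) (X : G.lie) (v : V) : V :=
  limUnder (𝓝[≠] (0 : ℝ)) fun t : ℝ => t⁻¹ • (a (expMap G.toClosedSubgroup (t • X)) v - v)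

/-- The action of `Z = A + i B ∈ 𝔰𝔩(2, ℂ)`, where `A, B ∈ 𝔤`, obtained by complexifying the
differentiated action of `𝔤`. -/
def lieAction (G : RealForm) (a : G.Pt → V → V) (Z : M2) (hZ : Z.trace = 0) (v : V) : V :=
  let p := (G.existsUnique_add_I_smul Z hZ).choose
  lieDeriv G a p.1 v + Complex.I • lieDeriv G a p.2 v

/-- The operator of `H = diag (1, -1)`. -/
def opH (G : RealForm) (a : G.Pt → V → V) : V → V :=
  lieAction G a !![1, 0; 0, -1] (by simp [Matrix.trace_fin_two])

/-- The operator of the upper triangular elementary matrix `X`. -/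
def opX (G : RealForm) (a : G.Pt → V → V) : V → V :=
  lieAction G a !![0, 1; 0, 0] (by simp [Matrix.trace_fin_two])

/-- The operator of the lower triangular elementary matrix `Y`. -/
def opY (G : RealForm) (a : G.Pt → V → V) : V → V :=
  lieAction G a !![0, 0; 1, 0] (by simp [Matrix.trace_fin_two])

/-- The action of the Casimir element `Ω = H² + 2 (X Y + Y X)`, which generates the centre
`𝔷(𝔤_ℂ) = ℂ[Ω]` of the enveloping algebra. -/
def casimir (G : RealForm) (a : G.Pt → V → V) (v : V) : V :=
  opH G a (opH G a v) + (2 : ℂ) • (opX G a (opY G a v) + opY G a (opX G a v))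

/-- The space has infinitesimal character `μ` (normalized so that the trivial representation has
infinitesimal character `1`): `Ω` acts by the scalar `μ² - 1`. -/
def HasInfChar (G : RealForm) (a : G.Pt → V → V) (μ : ℂ) : Prop :=
  ∀ v, casimir G a v = (μ ^ 2 - 1) • v

/-- The primary component `P_μ(V) = ⋃ₖ Ker (Ω - (μ² - 1))ᵏ`. -/
def primaryComponent (G : RealForm) (a : G.Pt → V → V) (μ : ℂ) : Set V :=
  {v | ∃ k : ℕ, (fun w => casimir G a w - (μ ^ 2 - 1) • w)^[k] v = 0}

/-- The diagonal action of `G` on `V ⊗ ℂ²`. The tensor product with the natural representation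
`ℂ² = ℂ f₀ ⊕ ℂ f₁` is realized as `V ⊕ V` (with its product topology), `u` standing for
`u 0 ⊗ f₀ + u 1 ⊗ f₁`; here `g fⱼ = ∑ᵢ gᵢⱼ fᵢ`. -/
def tensorStd (G : RealForm) (a : G.Pt → V → V) (g : G.Pt) (u : Fin 2 → V) : Fin 2 → V :=
  fun i => ∑ j, ((g : SL2C) : M2) i j • a g (u j)

end Action

/-! ### Smooth admissible representations of finite length and moderate growth -/

/-- A map of class `C^k` between real topological vector spaces, `E` being finite-dimensional:
it is continuous and, if `k ≥ 1`, all its directional derivatives exist at every point and are of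
class `C^(k-1)`. -/
def IsOfClass {E F : Type*} [AddCommGroup E] [Module ℝ E] [TopologicalSpace E]
    [AddCommGroup F] [Module ℝ F] [TopologicalSpace F] : ℕ → (E → F) → Prop
  | 0, f => Continuous f
  | k + 1, f => Continuous f ∧ ∀ e : E, ∃ f' : E → F,
      (∀ x, Tendsto (fun t : ℝ => t⁻¹ • (f (x + t • e) - f x)) (𝓝[≠] 0) (𝓝 (f' x))) ∧
      IsOfClass k f'

section Conditions

variable {V : Type u} [AddCommGroup V] [Module ℂ V] [TopologicalSpace V]

/-- Every vector is smooth: each orbit map `g ↦ ρ(g) v` is `C^∞`. By homogeneity it is enough to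
require this in exponential coordinates at the identity. -/
def IsSmoothRep (G : RealForm) (ρ : G.Pt →* (V →L[ℂ] V)) : Prop :=
  ∀ (v : V) (k : ℕ), IsOfClass k fun X : G.lie => ρ (expMap G.toClosedSubgroup X) v

/-- Moderate growth: for every continuous seminorm `p` there are a continuous seminorm `q` and `N`
with `p (ρ(g) v) ≤ ‖g‖^N q(v)`, where `‖g‖` is the sum of the absolute values of the entries of
`g`. -/
def IsModerateGrowth (G : RealForm) (ρ : G.Pt →* (V →L[ℂ] V)) : Prop :=
  ∀ p : Seminorm ℂ V, Continuous p → ∃ q : Seminorm ℂ V, Continuous q ∧ ∃ N : ℕ,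
    ∀ (g : G.Pt) (v : V), p (ρ g v) ≤ (∑ i, ∑ j, ‖((g : SL2C) : M2) i j‖) ^ N * q v

/-- `K` is a maximal compact subgroup of `G`. -/
def IsMaximalCompact (G : RealForm) (K : Subgroup G.Pt) : Prop :=
  IsCompact (K : Set G.Pt) ∧
    ∀ L : Subgroup G.Pt, IsCompact (L : Set G.Pt) → K ≤ L → L = K

/-- The space `Hom_K(τ, V)`, for a matrix representation `τ` of `K` on `ℂⁿ`; a homomorphism is
given by the images `w j` of the basis vectors. -/
def homK (G : RealForm) (ρ : G.Pt →* (V →L[ℂ] V)) (K : Subgroup G.Pt) {n : ℕ}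
    (τ : K →* Matrix (Fin n) (Fin n) ℂ) : Submodule ℂ (Fin n → V) where
  carrier := {w | ∀ (k : K) (j : Fin n), ρ (k : G.Pt) (w j) = ∑ i, τ k i j • w i}
  zero_mem' := by simp
  add_mem' := fun {x y} hx hy k j => by
    simp only [Pi.add_apply, map_add, hx k j, hy k j, smul_add, Finset.sum_add_distrib]
  smul_mem' := fun c x hx k j => by
    simp only [Pi.smul_apply, map_smul, hx k j, Finset.smul_sum, smul_comm c]

/-- Admissibility: every finite-dimensional continuous representation of a maximal compact subgroup
occurs in `V` with finite multiplicity. -/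
def IsAdmissible (G : RealForm) (ρ : G.Pt →* (V →L[ℂ] V)) : Prop :=
  ∀ K : Subgroup G.Pt, IsMaximalCompact G K →
    ∀ (n : ℕ) (τ : K →* Matrix (Fin n) (Fin n) ℂ), Continuous τ →
      FiniteDimensional ℂ (homK G ρ K τ)

/-- A closed `G`-invariant subspace. -/
def IsClosedInvariant (G : RealForm) (ρ : G.Pt →* (V →L[ℂ] V)) (W : Submodule ℂ V) : Prop :=
  IsClosed (W : Set V) ∧ ∀ g, ∀ w ∈ W, ρ g w ∈ W

/-- Finite length: there is a finite chain `0 = W₀ ⊂ W₁ ⊂ ⋯ ⊂ Wₙ = V` of closed invariant subspaces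
with topologically irreducible successive quotients. -/
def IsFiniteLength (G : RealForm) (ρ : G.Pt →* (V →L[ℂ] V)) : Prop :=
  ∃ (n : ℕ) (W : Fin (n + 1) → Submodule ℂ V), W 0 = ⊥ ∧ W (Fin.last n) = ⊤ ∧
    (∀ i, IsClosedInvariant G ρ (W i)) ∧
    ∀ i : Fin n, W i.castSucc < W i.succ ∧
      ∀ U, IsClosedInvariant G ρ U → W i.castSucc ≤ U → U ≤ W i.succ →
        U = W i.castSucc ∨ U = W i.succ

end Conditions

/-- An object of the category `𝓜(G)`: an admissible smooth representation of `G` of finite length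
and of moderate growth on a Fréchet space. -/
structure SmoothRep (G : RealForm) : Type (u + 1) where
  V : Type u
  [addCommGroup : AddCommGroup V]
  [module : Module ℂ V]
  [uniformSpace : UniformSpace V]
  [isUniformAddGroup : IsUniformAddGroup V]
  [continuousSMul : ContinuousSMul ℂ V]
  [locallyConvexSpace : LocallyConvexSpace ℝ V]
  [t2Space : T2Space V]
  [completeSpace : CompleteSpace V]
  [firstCountable : FirstCountableTopology V]
  ρ : G.Pt →* (V →L[ℂ] V)
  continuous_action : Continuous fun p : G.Pt × V => ρ p.1 p.2
  smooth : IsSmoothRep G ρ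
  moderateGrowth : IsModerateGrowth G ρ
  admissible : IsAdmissible G ρ
  finiteLength : IsFiniteLength G ρ

attribute [instance] SmoothRep.addCommGroup SmoothRep.module SmoothRep.uniformSpace
  SmoothRep.isUniformAddGroup SmoothRep.continuousSMul SmoothRep.locallyConvexSpace
  SmoothRep.t2Space SmoothRep.completeSpace SmoothRep.firstCountable

/-- The action map of a representation. -/
def SmoothRep.act {G : RealForm} (π : SmoothRep.{u} G) (g : G.Pt) (v : π.V) : π.V := π.ρ g v

/-! ### Reduced coherent families -/

/-- The parameter set `Λ(ξ)`, for `ξ ≠ 0`: it is `ξ + ℤ` if `ξ ∉ ℤ`, and the set of all integers of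
the same sign as `ξ` if `ξ ∈ ℤ`. -/
def paramSet (ξ : ℂ) : Set ℂ :=
  {l | ((∀ n : ℤ, ξ ≠ n) ∧ ∃ m : ℤ, l = ξ + m) ∨
    ((∃ n : ℤ, 0 < n ∧ ξ = n) ∧ ∃ m : ℤ, 0 < m ∧ l = m) ∨
    ((∃ n : ℤ, n < 0 ∧ ξ = n) ∧ ∃ m : ℤ, m < 0 ∧ l = m)}

/-- `P_μ(π ⊗ ℂ²) ≃ π'` as topological representations of `G`; `j` is the inverse isomorphism,
viewed as an embedding of `π'` into `π ⊗ ℂ²` with image the primary component. -/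
def PrimaryIso {G : RealForm} (π : SmoothRep.{u} G) (μ : ℂ) (π' : SmoothRep.{u} G) : Prop :=
  ∃ j : π'.V →L[ℂ] (Fin 2 → π.V), IsEmbedding j ∧
    Set.range j = primaryComponent G (tensorStd G π.act) μ ∧
    ∀ (g : G.Pt) (w : π'.V), j (π'.act g w) = tensorStd G π.act g (j w)

/-- `P` is a reduced coherent family through the representation `π` of infinitesimal
character `ξ`. -/
structure IsReducedCoherentFamily {G : RealForm} (π : SmoothRep.{u} G) (ξ : ℂ)
    (P : paramSet ξ → SmoothRep.{u} G) : Prop where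
  passes_through : ∀ l : paramSet ξ, (l : ℂ) = ξ → P l = π
  infChar : ∀ l : paramSet ξ, HasInfChar G (P l).act l
  coherent : ∀ δ : ℂ, δ = 1 ∨ δ = -1 → ∀ l l' : paramSet ξ, (l' : ℂ) = l + δ →
    PrimaryIso (P l) (l + δ) (P l') ∧ PrimaryIso (P l') l (P l)

/-! ### Symmetry breaking operators and multiplicities -/

/-- `{H, X, Y}` is an `𝔰𝔩₂`-triple of matrices. -/
structure IsTriple (H X Y : M2) : Prop where
  ne_zero : H ≠ 0
  comm_HX : H * X - X * H = (2 : ℂ) • X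
  comm_HY : H * Y - Y * H = -((2 : ℂ) • Y)
  comm_XY : X * Y - Y * X = H

/-- The value at `g ∈ G'` of the character `ℂ_ν` (`ν ∈ ℤ`) of a connected group `G'` with
complexified Lie algebra `ℂ H`, where `H` belongs to an `𝔰𝔩₂`-triple: `(1 + H) / 2` is the projection
onto the `1`-eigenspace of `H`, so that the trace is the eigenvalue of `g` on that line. It
satisfies `exp (w H) ↦ exp (ν w)`, see `weightChar_exp`. -/
def weightChar (H : M2) (ν : ℤ) (g : SL2C) : ℂ :=
  ((g : M2) * ((1 / 2 : ℂ) • (1 + H))).trace ^ ν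

theorem IsTriple.sq_eq_one {H X Y : M2} (h : IsTriple H X Y) : H * H = 1 := by
  have ht : H 0 0 + H 1 1 = 0 := by
    rw [← Matrix.trace_fin_two, ← h.comm_XY, Matrix.trace_sub, Matrix.trace_mul_comm, sub_self]
  have hd : H * H = (H 0 0 * H 0 0 + H 0 1 * H 1 0) • (1 : M2) := by
    have h1 : H 1 1 = -H 0 0 := by linear_combination ht
    ext i j
    fin_cases i <;> fin_cases j <;> simp [Matrix.mul_apply, Fin.sum_univ_two, h1] <;> ring
  set d := H 0 0 * H 0 0 + H 0 1 * H 1 0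
  have hx := h.comm_HX
  have e1 : H * (H * X - X * H) + (H * X - X * H) * H = 0 := by
    have : H * (H * X - X * H) + (H * X - X * H) * H = (H * H) * X - X * (H * H) := by noncomm_ring
    rw [this, hd]; simp
  rw [hx] at e1
  have e2 : H * X = X := by
    have h2 : (2 : ℂ) • (H * X + X * H) = 0 := by
      rw [← e1, smul_add, mul_smul_comm, smul_mul_assoc]
    have h3 : H * X + X * H = 0 := (smul_eq_zero.1 h2).resolve_left two_ne_zero
    have h4 : X * H = -(H * X) := (neg_eq_of_add_eq_zero_right h3).symm
    rw [h4, sub_neg_eq_add, ← two_smul ℂ] at hx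
    exact smul_right_injective _ (two_ne_zero (α := ℂ)) hx
  have e3 : d • X = X := by
    calc d • X = (H * H) * X := by rw [hd]; simp
      _ = X := by rw [mul_assoc, e2, e2]
  have hX : X ≠ 0 := fun h0 => h.ne_zero (by rw [← h.comm_XY, h0]; simp)
  have e4 : (d - 1) • X = 0 := by rw [sub_smul, e3, one_smul, sub_self]
  have e5 : d = 1 := sub_eq_zero.1 ((smul_eq_zero.1 e4).resolve_right hX)
  rw [hd, e5, one_smul]

open scoped Matrix.Norms.Operator in
theorem exp_mul_of_mul_eq_smul {A P : M2} {w : ℂ} (h : A * P = w • P) :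
    NormedSpace.exp A * P = Complex.exp w • P := by
  have hp : ∀ n : ℕ, A ^ n * P = w ^ n • P := by
    intro n
    induction n with
    | zero => simp
    | succ n ih => rw [pow_succ, mul_assoc, h, mul_smul_comm, ih, smul_smul, pow_succ, mul_comm]
  have h1 := (NormedSpace.exp_series_hasSum_exp' (𝕂 := ℂ) A).mul_right P
  have h2 := (NormedSpace.exp_series_hasSum_exp' (𝕂 := ℂ) w).smul_const P
  rw [← Complex.exp_eq_exp_ℂ] at h2
  refine h1.unique (h2.congr_fun fun n => ?_)
  rw [smul_mul_assoc, hp, smul_smul, smul_eq_mul]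

/-- On one-parameter subgroups, `ℂ_ν` is `exp (w H) ↦ exp (ν w)`. -/
theorem weightChar_exp {H X Y : M2} (h : IsTriple H X Y) (ν : ℤ) (w : ℂ) (g : SL2C)
    (hg : (g : M2) = NormedSpace.exp (w • H)) : weightChar H ν g = Complex.exp (ν * w) := by
  have hP : (w • H) * ((1 / 2 : ℂ) • (1 + H)) = w • ((1 / 2 : ℂ) • (1 + H)) := by
    rw [smul_mul_assoc, mul_smul_comm, mul_add, mul_one, h.sq_eq_one, add_comm H]
  have ht : H.trace = 0 := by
    rw [← h.comm_XY, Matrix.trace_sub, Matrix.trace_mul_comm, sub_self]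
  rw [weightChar, hg, exp_mul_of_mul_eq_smul hP, Matrix.trace_smul, Matrix.trace_smul,
    Matrix.trace_add, ht, Matrix.trace_one, Complex.exp_int_mul]
  simp

/-- The space `Hom_{G'}(π|_{G'}, ℂ_ν)` of symmetry breaking operators: continuous linear maps
`T : π → ℂ` with `T (ρ(g) v) = ℂ_ν(g) T v` for all `g ∈ G'`. -/
def symmetryBreaking {G : RealForm} (G' : Subgroup SL2C) (hle : G' ≤ G.toSubgroup) (H : M2)
    (π : SmoothRep.{u} G) (ν : ℤ) : Submodule ℂ (π.V →L[ℂ] ℂ) where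
  carrier := {T | ∀ (g : SL2C) (hg : g ∈ G') (v : π.V),
    T (π.ρ ⟨g, hle hg⟩ v) = weightChar H ν g * T v}
  zero_mem' := by simp
  add_mem' := fun {S T} hS hT g hg v => by
    simp only [add_apply, hS g hg v, hT g hg v, mul_add]
  smul_mem' := fun c T hT g hg v => by
    simp only [smul_apply, hT g hg v, smul_eq_mul]; ring

/-- The multiplicity `[π : ℂ_ν] = dim Hom_{G'}(π|_{G'}, ℂ_ν)`. -/
def sbMultiplicity {G : RealForm} (G' : Subgroup SL2C) (hle : G' ≤ G.toSubgroup) (H : M2)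
    (π : SmoothRep.{u} G) (ν : ℤ) : Cardinal.{u} :=
  Module.rank ℂ (symmetryBreaking G' hle H π ν)

/-! ### Regions in the parameter space `Ξ = Λ(ξ) × ℤ` -/

/-- `Ξ_even`: `λ ≡ ν mod 2`. -/
def evenRegion (ξ : ℂ) : Set (paramSet ξ × ℤ) :=
  {p | ∃ k : ℤ, (p.1 : ℂ) = p.2 + 2 * k}

/-- `Ξ_odd`: `λ ≡ ν + 1 mod 2`. -/
def oddRegion (ξ : ℂ) : Set (paramSet ξ × ℤ) :=
  {p | ∃ k : ℤ, (p.1 : ℂ) = p.2 + 1 + 2 * k}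

/-- The part `ν ≥ λ + 1` of `Ξ_odd`. -/
def oddUp (ξ : ℂ) : Set (paramSet ξ × ℤ) :=
  {p ∈ oddRegion ξ | (p.1 : ℂ).re + 1 ≤ p.2}

/-- The part `λ ≥ |ν| + 1` of `Ξ_odd`. -/
def oddRight (ξ : ℂ) : Set (paramSet ξ × ℤ) :=
  {p ∈ oddRegion ξ | |(p.2 : ℝ)| + 1 ≤ (p.1 : ℂ).re}

/-- The part `ν ≤ -λ - 1` of `Ξ_odd`. -/
def oddDown (ξ : ℂ) : Set (paramSet ξ × ℤ) :=
  {p ∈ oddRegion ξ | (p.2 : ℝ) ≤ -(p.1 : ℂ).re - 1}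

end SL2Branching

end

open SL2Branching

noncomputable section

namespace SL2Branching

universe u

/-! ### Functional analysis on the representation space -/

namespace SmoothRep

variable {G : RealForm} (π : SmoothRep.{u} G)

/-! Multiplicities are compared by translating symmetry breaking operators through `ℂ²`. Let `T ∈
Hom_{G'}(π, ℂ_ν)`, let `e` be a functional on `ℂ²` of weight `s = ±1` under `G'`, and let `π' ≃
P_{μ+δ}(π ⊗ ℂ²)`. Restricting `T ⊗ e` to this component gives an element of `Hom_{G'}(π', ℂ_{ν+s})`.
The Casimir element acts on `π ⊗ ℂ²` by `μ² + 2 + 2M` with `M = H⊗H + 2(X⊗Y + Y⊗X)`, and `(M + 1)² =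
μ²`, so the image of `M + 1 + δμ` lies in `P_{μ+δ}`. If `c` is the weight vector dual to `e`, then
`T ⊗ e` takes `(M + 1 + δμ)(v ⊗ c)` to `(sν + δμ + 1) T v`. Hence translation is injective when this
factor is nonzero (`sbMultiplicity_le`). The reverse translation has the opposite factor, so the
same condition gives equality (`sbMultiplicity_eq`).

What remains is a walk on the lattice of pairs `(λ, ν)` by diagonal steps, a step being blocked when
`sν + δλ + 1 = 0`. For `ξ ∉ ℤ` nothing is blocked and parity is the only invariant. For `ξ ∈ ℕ₊` the
factor is odd when `λ ≡ ν`, so even points are never blocked; the blocked steps between odd points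
are those crossing the lines `λ = ±ν`, which separate the three odd regions.

The analytic input is that the complexified Lie algebra acts by continuous operators obeying the
bracket relations (`diffAction`, `diffAction_comm`). -/

instance continuousSMul_real : ContinuousSMul ℝ π.V := IsScalarTower.continuousSMul ℂ

/-- A Fréchet space is a Baire space, hence barrelled. This is what makes pointwise limits of
difference quotients continuous in `lieCLM`. -/
instance barrelledSpace : BarrelledSpace ℂ π.V := by
  have : (uniformity π.V).IsCountablyGenerated :=
    IsUniformAddGroup.uniformity_countably_generated
  infer_instance

instance polynormableSpace : PolynormableSpace ℂ π.V := by
  open scoped ComplexOrder in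
  have : LocallyConvexSpace ℂ π.V := ⟨fun x => by
    refine (LocallyConvexSpace.convex_basis (𝕜 := ℝ) x).congr (fun s => ?_) fun _ _ => rfl
    rw [convex_RCLike_iff_convex_real (K := ℂ)]⟩
  exact LocallyConvexSpace.toPolynormableSpace

end SmoothRep

/-! ### The Lie algebra of a closed subgroup -/

theorem tendsto_slope_exp_smul {A : Type*} [NormedRing A] [NormedAlgebra ℝ A] [CompleteSpace A]
    (X : A) :
    Tendsto (fun t : ℝ => t⁻¹ • (NormedSpace.exp (t • X) - 1)) (𝓝[≠] 0) (𝓝 X) := by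
  let : NormedAlgebra ℚ A := NormedAlgebra.restrictScalars ℚ ℝ A
  have h := hasDerivAt_exp_smul_const (𝕂 := ℝ) X 0
  rw [hasDerivAt_iff_tendsto_slope_zero] at h
  simpa using h

theorem continuous_exp_smul {A : Type*} [NormedRing A] [NormedAlgebra ℝ A] [CompleteSpace A]
    (X : A) : Continuous (fun t : ℝ => NormedSpace.exp (t • X)) :=
  continuous_iff_continuousAt.2 fun t =>
    (hasDerivAt_exp_smul_const (𝕂 := ℝ) X t).continuousAt

open scoped Matrix.Norms.Operator in
theorem tendsto_slope_matrix_exp (X : M2) :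
    Tendsto (fun t : ℝ => t⁻¹ • (NormedSpace.exp (t • X) - 1)) (𝓝[≠] 0) (𝓝 X) :=
  tendsto_slope_exp_smul X

open scoped Matrix.Norms.Operator in
theorem continuous_matrix_exp_smul (X : M2) :
    Continuous (fun t : ℝ => NormedSpace.exp (t • X)) :=
  continuous_exp_smul X

theorem trace_eq_zero_of_mem_lieAlg {G : ClosedSubgroup SL2C} {A : M2} (hA : A ∈ lieAlg G) :
    A.trace = 0 := by
  have hs := tendsto_slope_matrix_exp A
  have he (i j : Fin 2) := ((continuous_id.matrix_elem i j).tendsto A).comp hs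
  have hc (i j : Fin 2) : Tendsto (fun t : ℝ => (NormedSpace.exp (t • A)) i j) (𝓝[≠] 0)
      (𝓝 ((1 : M2) i j)) := by
    have h := ((continuous_matrix_exp_smul A).tendsto 0).mono_left (nhdsWithin_le_nhds (s := {0}ᶜ))
    simp only [zero_smul, NormedSpace.exp_zero] at h
    exact ((continuous_id.matrix_elem i j).tendsto _).comp h
  have hdet (t : ℝ) : (NormedSpace.exp (t • A)).det = 1 := by
    obtain ⟨g, -, h⟩ := hA t
    rw [← h, g.2]
  -- For `exp (tA)` with entries `a, b, c, d`, the combination `((a - 1)d + (d - 1) - bc) / t`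
  -- equals `(det - 1) / t = 0`, while its limit at `t = 0` is the trace.
  have h := ((he 0 0).mul (hc 1 1)).add ((he 1 1).sub ((he 0 1).mul (hc 1 0)))
  simp only [Function.comp_def, id, Matrix.one_apply_eq, mul_one, ne_eq, one_ne_zero,
    not_false_eq_true, Matrix.one_apply_ne, mul_zero, sub_zero] at h
  rw [Matrix.trace_fin_two]
  refine tendsto_nhds_unique h (tendsto_const_nhds.congr fun t => ?_)
  have h1 := hdet t
  rw [Matrix.det_fin_two] at h1
  simp [Matrix.sub_apply, Matrix.smul_apply]
  linear_combination -(t : ℂ)⁻¹ * h1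

theorem exp_conj (g : SL2C) (A : M2) :
    NormedSpace.exp ((g : M2) * A * ((g⁻¹ : SL2C) : M2)) =
      (g : M2) * NormedSpace.exp A * ((g⁻¹ : SL2C) : M2) := by
  have h1 : (g : M2) * ((g⁻¹ : SL2C) : M2) = 1 := by
    rw [← Matrix.SpecialLinearGroup.coe_mul, mul_inv_cancel, Matrix.SpecialLinearGroup.coe_one]
  have h2 : IsUnit (g : M2) := by
    rw [Matrix.isUnit_iff_isUnit_det, g.2]; exact isUnit_one
  rw [← Matrix.inv_eq_right_inv h1, Matrix.exp_conj _ _ h2]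

theorem conj_mem_lieAlg {G : ClosedSubgroup SL2C} {g : SL2C} (hg : g ∈ G.toSubgroup) {A : M2}
    (hA : A ∈ lieAlg G) : (g : M2) * A * ((g⁻¹ : SL2C) : M2) ∈ lieAlg G := by
  intro t
  obtain ⟨k, hk, h⟩ := hA t
  refine ⟨g * k * g⁻¹, mul_mem (mul_mem hg hk) (inv_mem hg), ?_⟩
  rw [Matrix.SpecialLinearGroup.coe_mul, Matrix.SpecialLinearGroup.coe_mul, h, ← exp_conj,
    mul_smul_comm, smul_mul_assoc]

theorem expMap_injective_coe {G : ClosedSubgroup SL2C} {X : lieAlg G} {g : G.toSubgroup}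
    (h : ((g : SL2C) : M2) = NormedSpace.exp (X : M2)) : expMap G X = g :=
  Subtype.ext (Subtype.ext (by rw [coe_expMap, h]))

/-- The derivative of the orbit map in exponential coordinates. -/
theorem SmoothRep.tendsto_lieDeriv {G : RealForm} (π : SmoothRep.{u} G) (X : G.lie) (v : π.V) :
    Tendsto (fun t : ℝ => t⁻¹ • (π.act (expMap G.toClosedSubgroup (t • X)) v - v)) (𝓝[≠] 0)
      (𝓝 (lieDeriv G π.act X v)) := by
  obtain ⟨f', h, -⟩ := (π.smooth v 1).2 X
  have h := h 0
  have h0 : expMap G.toClosedSubgroup (0 : G.lie) = 1 := expMap_injective_coe (by simp)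
  simp only [zero_add, h0, map_one, one_apply_eq_self] at h
  exact tendsto_nhds_limUnder ⟨_, h⟩

/-- The operator of `X ∈ 𝔤`, which is continuous by the Banach-Steinhaus theorem. -/
def SmoothRep.lieCLM {G : RealForm} (π : SmoothRep.{u} G) (X : G.lie) :
    π.V →L[ℂ] π.V :=
  continuousLinearMapOfTendsto (l := 𝓝[≠] (0 : ℝ))
    (fun t : ℝ => (t : ℂ)⁻¹ • (π.ρ (expMap G.toClosedSubgroup (t • X)) - 1))
    (f := lieDeriv G π.act X) (tendsto_pi_nhds.2 fun v => by
      simpa [SmoothRep.act, ← Complex.ofReal_inv] using π.tendsto_lieDeriv X v)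

theorem SmoothRep.tendsto_lieCLM {G : RealForm} (π : SmoothRep.{u} G) (X : G.lie) (v : π.V) :
    Tendsto (fun t : ℝ => t⁻¹ • (π.ρ (expMap G.toClosedSubgroup (t • X)) v - v)) (𝓝[≠] 0)
      (𝓝 (π.lieCLM X v)) := π.tendsto_lieDeriv X v

section

theorem expMap_zero (G : ClosedSubgroup SL2C) : expMap G 0 = 1 := expMap_injective_coe (by simp)

theorem continuous_coe_SL2C : Continuous fun g : SL2C => (g : M2) :=
  Matrix.SpecialLinearGroup.isClosedEmbedding_val.continuous

theorem continuous_expMap_smul {G : ClosedSubgroup SL2C} (X : lieAlg G) :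
    Continuous fun t : ℝ => expMap G (t • X) := by
  refine Continuous.subtype_mk (f := fun t : ℝ => (expMap G (t • X) : SL2C)) ?_ _
  refine Matrix.SpecialLinearGroup.isClosedEmbedding_val.isEmbedding.continuous_iff.2 ?_
  change Continuous fun t : ℝ => ((expMap G (t • X) : SL2C) : M2)
  simp only [coe_expMap, Submodule.coe_smul]
  exact continuous_matrix_exp_smul (X : M2)

/-- For a function with a continuous partial derivative `f'` in the direction `Y`, the difference
quotient in the direction `Y` may be taken at a base point moving along a line. -/
theorem tendsto_slope_moving {E : Type*} [AddCommGroup E] [Module ℝ E] [TopologicalSpace E]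
    [IsTopologicalAddGroup E] [ContinuousSMul ℝ E] {f f' : E → ℝ} (hf' : Continuous f') (X Y : E)
    (h : ∀ x, Tendsto (fun t : ℝ => t⁻¹ • (f (x + t • Y) - f x)) (𝓝[≠] 0) (𝓝 (f' x))) :
    Tendsto (fun t : ℝ => t⁻¹ • (f (t • X + t • Y) - f (t • X))) (𝓝[≠] 0) (𝓝 (f' 0)) := by
  have hd (x : E) (s : ℝ) : HasDerivAt (fun s : ℝ => f (x + s • Y)) (f' (x + s • Y)) s := by
    rw [hasDerivAt_iff_tendsto_slope_zero]
    simpa [add_smul, add_assoc] using h (x + s • Y)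
  -- By the mean value theorem the quotient is `f'` at a point of the segment from `t • X` to `t • X
  -- + t • Y`, which shrinks to `0`; continuity of `f'` concludes.
  have hmv (t : ℝ) : ∃ θ ∈ Set.Ioo (0 : ℝ) 1,
      f (t • X + t • Y) - f (t • X) = t * f' (t • X + (θ * t) • Y) := by
    have hg (θ : ℝ) : HasDerivAt (fun θ : ℝ => f (t • X + (θ * t) • Y))
        (f' (t • X + (θ * t) • Y) * t) θ := by
      have h1 := (hd (t • X) (θ * t)).comp θ ((hasDerivAt_id θ).mul_const t)
      rwa [one_mul] at h1
    obtain ⟨θ, hθ, he⟩ := exists_hasDerivAt_eq_slope _ _ zero_lt_one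
      (fun θ _ => (hg θ).continuousAt.continuousWithinAt) fun θ _ => hg θ
    refine ⟨θ, hθ, ?_⟩
    rw [mul_comm, he]
    simp
  choose θ hθ he using hmv
  have h0 : Tendsto (fun t : ℝ => θ t * t) (𝓝[≠] 0) (𝓝 0) := by
    refine squeeze_zero_norm (a := fun t : ℝ => ‖t‖) (fun t => ?_) ?_
    · rw [norm_mul, Real.norm_of_nonneg (hθ t).1.le]
      exact mul_le_of_le_one_left (norm_nonneg _) (hθ t).2.le
    · exact tendsto_norm_zero.mono_left nhdsWithin_le_nhds
  have h1 : Tendsto (fun t : ℝ => t) (𝓝[≠] 0) (𝓝 0) := tendsto_id.mono_left nhdsWithin_le_nhds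
  have h2 : Tendsto (fun t : ℝ => t • X + (θ t * t) • Y) (𝓝[≠] 0) (𝓝 0) := by
    simpa using (h1.smul_const X).add (h0.smul_const Y)
  refine ((hf'.tendsto 0).comp h2).congr' ?_
  filter_upwards [self_mem_nhdsWithin] with t ht
  rw [he, smul_eq_mul, inv_mul_cancel_left₀ ht]
  rfl

/-! ### The complexified Lie algebra action -/

variable {G : RealForm} (π : SmoothRep.{u} G)

namespace SmoothRep

theorem lieCLM_smul (c : ℝ) (X : G.lie) : π.lieCLM (c • X) = (c : ℂ) • π.lieCLM X := by
  ext v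
  refine tendsto_nhds_unique (π.tendsto_lieCLM (c • X) v) ?_
  rcases eq_or_ne c 0 with rfl | hc
  · simp [expMap_zero]
  · have h : Tendsto (fun t : ℝ => t * c) (𝓝[≠] 0) (𝓝[≠] 0) := by
      refine tendsto_nhdsWithin_iff.2 ⟨?_, ?_⟩
      · have : Tendsto (fun t : ℝ => t * c) (𝓝 0) (𝓝 (0 * c)) := tendsto_id.mul_const c
        rw [zero_mul] at this
        exact this.mono_left nhdsWithin_le_nhds
      · filter_upwards [self_mem_nhdsWithin] with t ht
        exact mul_ne_zero ht hc
    have h1 := ((π.tendsto_lieCLM X v).comp h).const_smul c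
    refine (h1.congr fun t => ?_)
    simp only [Function.comp, smul_smul, mul_inv]
    congr 1
    field_simp

/-- The orbit map is `C¹` in exponential coordinates, so the increment along `t(X + Y)` splits into
one along `tX` from `0` and one along `tY` from the moving point `tX`. -/
theorem lieCLM_add (X Y : G.lie) : π.lieCLM (X + Y) = π.lieCLM X + π.lieCLM Y := by
  ext v
  obtain ⟨f', h, hc⟩ := (π.smooth v 1).2 Y
  have h0 : f' 0 = π.lieCLM Y v := by
    refine tendsto_nhds_unique (h 0) ?_
    simpa [expMap_zero] using π.tendsto_lieCLM Y v
  by_contra hne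
  -- A separating real functional reduces the claim to real-valued functions, where the mean value
  -- theorem applies.
  obtain ⟨l, hl⟩ := geometric_hahn_banach_point_point (E := π.V) hne
  refine hl.ne ?_
  have h1 := tendsto_slope_moving (f := fun x => l (π.ρ (expMap G.toClosedSubgroup x) v))
    (l.continuous.comp hc) X Y fun x => by
      simpa [Function.comp_def] using (l.continuous.tendsto _).comp (h x)
  have h2 := (l.continuous.tendsto _).comp (π.tendsto_lieCLM X v)
  have h3 := (l.continuous.tendsto _).comp (π.tendsto_lieCLM (X + Y) v)
  rw [add_apply, map_add, ← h0]
  refine tendsto_nhds_unique h3 ((h2.add h1).congr fun t => ?_)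
  simp [smul_add]
  ring

/-- The action of a traceless matrix `Z`, as a continuous linear map. -/
def cplxCLM (Z : M2) (hZ : Z.trace = 0) : π.V →L[ℂ] π.V :=
  let p := (G.existsUnique_add_I_smul Z hZ).choose
  π.lieCLM p.1 + Complex.I • π.lieCLM p.2

theorem cplxCLM_apply (Z : M2) (hZ : Z.trace = 0) (v : π.V) :
    π.cplxCLM Z hZ v = lieAction G π.act Z hZ v := rfl

theorem cplxCLM_eq {Z : M2} (hZ : Z.trace = 0) (A B : G.lie)
    (h : Z = (A : M2) + Complex.I • (B : M2)) :
    π.cplxCLM Z hZ = π.lieCLM A + Complex.I • π.lieCLM B := by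
  have := (G.existsUnique_add_I_smul Z hZ).unique
    (G.existsUnique_add_I_smul Z hZ).choose_spec.1 (y₂ := (A, B)) h
  simp only [cplxCLM, this]

theorem cplxCLM_add {Z W : M2} (hZ : Z.trace = 0) (hW : W.trace = 0) (h : (Z + W).trace = 0) :
    π.cplxCLM (Z + W) h = π.cplxCLM Z hZ + π.cplxCLM W hW := by
  obtain ⟨⟨A, B⟩, e, -⟩ := G.existsUnique_add_I_smul Z hZ
  obtain ⟨⟨C, D⟩, e', -⟩ := G.existsUnique_add_I_smul W hW
  rw [π.cplxCLM_eq hZ A B e, π.cplxCLM_eq hW C D e', π.cplxCLM_eq h (A + C) (B + D),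
    lieCLM_add, lieCLM_add, smul_add]
  · abel
  · rw [e, e', Submodule.coe_add, Submodule.coe_add, smul_add]
    abel

theorem cplxCLM_smul {Z : M2} (hZ : Z.trace = 0) (c : ℂ) (h : (c • Z).trace = 0) :
    π.cplxCLM (c • Z) h = c • π.cplxCLM Z hZ := by
  obtain ⟨⟨A, B⟩, e, -⟩ := G.existsUnique_add_I_smul Z hZ
  have hI : (c.re : ℂ) + c.im * Complex.I = c := Complex.re_add_im c
  rw [π.cplxCLM_eq hZ A B e, π.cplxCLM_eq h (c.re • A + (-c.im) • B) (c.re • B + c.im • A)]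
  · simp only [lieCLM_add, lieCLM_smul, Complex.ofReal_neg]
    nth_rw 5 [← hI]
    match_scalars
    · ring
    · linear_combination (-c.im : ℂ) * Complex.I_sq
  · rw [e]
    ext i j
    simp only [Matrix.add_apply, Matrix.smul_apply, smul_eq_mul, Submodule.coe_add,
      Submodule.coe_smul, Complex.real_smul, Complex.ofReal_neg]
    nth_rw 1 [← hI]
    linear_combination (c.im * (B : M2) i j) * Complex.I_sq

/-- The complexified differentiated action, extended by zero on scalar matrices. -/
def diffAction : M2 →ₗ[ℂ] (π.V →L[ℂ] π.V) where
  toFun Z := ((Z 0 0 - Z 1 1) / 2) • π.cplxCLM !![1, 0; 0, -1] (by simp [Matrix.trace_fin_two]) +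
    Z 0 1 • π.cplxCLM !![0, 1; 0, 0] (by simp [Matrix.trace_fin_two]) +
    Z 1 0 • π.cplxCLM !![0, 0; 1, 0] (by simp [Matrix.trace_fin_two])
  map_add' Z W := by
    simp only [Matrix.add_apply]
    module
  map_smul' c Z := by
    simp only [Matrix.smul_apply, smul_eq_mul, RingHom.id_apply]
    module

/-- This exchanges an operator depending on a proof of tracelessness for one linear on all matrices,
so that later identities follow from `map_add` and `map_smul`. -/
theorem diffAction_eq_cplxCLM (Z : M2) (hZ : Z.trace = 0) : π.diffAction Z = π.cplxCLM Z hZ := by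
  have e : Z = ((Z 0 0 - Z 1 1) / 2) • (!![1, 0; 0, -1] : M2) + Z 0 1 • (!![0, 1; 0, 0] : M2) +
      Z 1 0 • (!![0, 0; 1, 0] : M2) := by
    rw [Matrix.trace_fin_two] at hZ
    ext i j
    fin_cases i <;> fin_cases j <;> simp
    · linear_combination hZ / 2
    · linear_combination hZ / 2
  have h (z w t : ℂ) : (z • (!![1, 0; 0, -1] : M2) + w • (!![0, 1; 0, 0] : M2) +
      t • (!![0, 0; 1, 0] : M2)).trace = 0 := by simp [Matrix.trace_fin_two]
  have h' (z w : ℂ) : (z • (!![1, 0; 0, -1] : M2) + w • (!![0, 1; 0, 0] : M2)).trace = 0 := by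
    simp [Matrix.trace_fin_two]
  have key (z w t : ℂ) : π.cplxCLM (z • (!![1, 0; 0, -1] : M2) + w • (!![0, 1; 0, 0] : M2) +
      t • (!![0, 0; 1, 0] : M2)) (h z w t) =
      z • π.cplxCLM !![1, 0; 0, -1] (by simp [Matrix.trace_fin_two]) +
      w • π.cplxCLM !![0, 1; 0, 0] (by simp [Matrix.trace_fin_two]) +
      t • π.cplxCLM !![0, 0; 1, 0] (by simp [Matrix.trace_fin_two]) := by
    rw [π.cplxCLM_add (h' z w) (by simp [Matrix.trace_fin_two]) _,
      π.cplxCLM_add (by simp [Matrix.trace_fin_two]) (by simp [Matrix.trace_fin_two]) _,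
      π.cplxCLM_smul, π.cplxCLM_smul, π.cplxCLM_smul]
  simp only [diffAction, LinearMap.coe_mk, AddHom.coe_mk]
  rw [← key]
  congr 1
  exact e.symm

theorem diffAction_apply_eq_lieAction (Z : M2) (hZ : Z.trace = 0) (v : π.V) :
    π.diffAction Z v = lieAction G π.act Z hZ v := by
  rw [diffAction_eq_cplxCLM, cplxCLM_apply]

theorem diffAction_coe (X : G.lie) : π.diffAction X = π.lieCLM X := by
  have h0 : π.lieCLM 0 = 0 := by simpa using π.lieCLM_smul 0 0
  rw [diffAction_eq_cplxCLM _ _ (trace_eq_zero_of_mem_lieAlg X.2), π.cplxCLM_eq _ X 0 (by simp),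
    h0, smul_zero, add_zero]

theorem continuous_diffAction : Continuous fun p : M2 × π.V => π.diffAction p.1 p.2 := by
  have hc (i j : Fin 2) : Continuous fun p : M2 × π.V => p.1 i j :=
    continuous_fst.matrix_elem i j
  have := hc 0 0
  have := hc 0 1
  have := hc 1 0
  have := hc 1 1
  simp only [diffAction, LinearMap.coe_mk, AddHom.coe_mk, add_apply, smul_apply]
  fun_prop

/-- Differentiate `g exp(tX) = exp(t Ad(g)X) g` at `t = 0`. -/
theorem ρ_diffAction (g : G.Pt) (X : G.lie) (v : π.V) :
    π.ρ g (π.diffAction X v) =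
      π.diffAction ((g : SL2C) * (X : M2) * (((g : SL2C)⁻¹ : SL2C) : M2)) (π.ρ g v) := by
  set Z : G.lie := ⟨_, conj_mem_lieAlg g.2 X.2⟩ with hZ
  have hg (t : ℝ) : expMap G.toClosedSubgroup (t • Z) * g =
      g * expMap G.toClosedSubgroup (t • X) := by
    rw [← eq_mul_inv_iff_mul_eq]
    refine expMap_injective_coe ?_
    have := exp_conj (g : SL2C) (t • (X : M2))
    simp only [mul_smul_comm, smul_mul_assoc] at this
    rw [Subgroup.coe_mul, Subgroup.coe_mul, Subgroup.coe_inv, Matrix.SpecialLinearGroup.coe_mul,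
      Matrix.SpecialLinearGroup.coe_mul, coe_expMap, Submodule.coe_smul, Submodule.coe_smul, this]
  change _ = π.diffAction (Z : M2) _
  rw [diffAction_coe, diffAction_coe]
  refine tendsto_nhds_unique
    (((π.ρ g).continuous.tendsto _).comp (π.tendsto_lieCLM X v)) ?_
  refine (π.tendsto_lieCLM Z (π.ρ g v)).congr fun t => ?_
  rw [← mul_apply_eq_comp, ← map_mul, hg, map_mul, mul_apply_eq_comp]
  rw [Function.comp_apply, ContinuousLinearMap.map_smul_of_tower, map_sub]

end SmoothRep

/-- The derivative of `Ad` is `ad`; this produces the bracket in `diffAction_comm_of_mem`. -/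
theorem tendsto_slope_conj {G : ClosedSubgroup SL2C} (X : lieAlg G) (B : M2) :
    Tendsto (fun t : ℝ => t⁻¹ • ((expMap G (t • X) : SL2C) * B *
      (((expMap G (t • X) : SL2C)⁻¹ : SL2C) : M2) - B)) (𝓝[≠] 0)
      (𝓝 ((X : M2) * B - B * (X : M2))) := by
  have hi (t : ℝ) : (((expMap G (t • X) : SL2C)⁻¹ : SL2C) : M2) =
      NormedSpace.exp (t • (-(X : M2))) := by
    have h1 : ((expMap G (t • X) : SL2C) : M2) * (((expMap G (t • X) : SL2C)⁻¹ : SL2C) : M2) = 1 := by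
      rw [← Matrix.SpecialLinearGroup.coe_mul, mul_inv_cancel, Matrix.SpecialLinearGroup.coe_one]
    rw [smul_neg, Matrix.exp_neg, ← Matrix.inv_eq_right_inv h1, coe_expMap]
    rfl
  have h1 := tendsto_slope_matrix_exp (X : M2)
  have h2 := tendsto_slope_matrix_exp (-(X : M2))
  have h3 := ((continuous_matrix_exp_smul (-(X : M2))).tendsto 0).mono_left
    (nhdsWithin_le_nhds (s := {0}ᶜ))
  simp only [zero_smul, NormedSpace.exp_zero] at h3
  have h := ((h1.mul_const B).mul h3).add (h2.const_mul B)
  rw [mul_one, mul_neg, ← sub_eq_add_neg] at h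
  refine h.congr fun t => ?_
  rw [hi, coe_expMap, Submodule.coe_smul]
  simp only [smul_mul_assoc, mul_smul_comm, ← smul_add]
  congr 1
  noncomm_ring

namespace SmoothRep

/-- Differentiate `ρ_diffAction` along `g = exp(tX)`. The product rule on the right-hand side needs
the joint continuity in `continuous_diffAction`, since the matrix and the vector both move. -/
theorem diffAction_comm_of_mem (X Y : G.lie) :
    π.diffAction X * π.diffAction Y - π.diffAction Y * π.diffAction X =
      π.diffAction ((X : M2) * Y - Y * X) := by
  ext v
  rw [sub_apply, sub_eq_iff_eq_add]
  have h1 := π.tendsto_lieCLM X (π.diffAction Y v)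
  have h2 := π.tendsto_lieCLM X v
  have h3 : Tendsto (fun t : ℝ => π.ρ (expMap G.toClosedSubgroup (t • X)) v) (𝓝[≠] 0) (𝓝 v) := by
    have := (π.continuous_action.comp
      ((continuous_expMap_smul X).prodMk (continuous_const (y := v)))).tendsto 0
    simp only [Function.comp, zero_smul, expMap_zero, map_one, one_apply_eq_self] at this
    exact this.mono_left nhdsWithin_le_nhds
  have h4 := (π.continuous_diffAction.tendsto _).comp
    ((tendsto_slope_conj X (Y : M2)).prodMk_nhds h3)
  have h5 := h4.add (((π.diffAction Y).continuous.tendsto _).comp h2)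
  rw [← diffAction_coe] at h1 h5
  refine tendsto_nhds_unique h1 (h5.congr fun t => ?_)
  simp only [Function.comp]
  rw [ρ_diffAction, LinearMap.map_smul_of_tower, map_sub,
    ContinuousLinearMap.map_smul_of_tower, map_sub, smul_apply, sub_apply, ← smul_add]
  congr 1
  abel

theorem diffAction_comm {Z W : M2} (hZ : Z.trace = 0) (hW : W.trace = 0) :
    π.diffAction Z * π.diffAction W - π.diffAction W * π.diffAction Z =
      π.diffAction (Z * W - W * Z) := by
  obtain ⟨⟨A, B⟩, e, -⟩ := G.existsUnique_add_I_smul Z hZ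
  obtain ⟨⟨C, D⟩, e', -⟩ := G.existsUnique_add_I_smul W hW
  have h1 := π.diffAction_comm_of_mem A C
  have h2 := π.diffAction_comm_of_mem A D
  have h3 := π.diffAction_comm_of_mem B C
  have h4 := π.diffAction_comm_of_mem B D
  simp only at e e'
  have e2 : Z * W - W * Z = ((A : M2) * C - C * A) + Complex.I • ((A : M2) * D - D * A) +
      Complex.I • ((B : M2) * C - C * B) + (Complex.I * Complex.I) • ((B : M2) * D - D * B) := by
    rw [e, e', mul_smul]
    simp only [mul_add, add_mul, mul_smul_comm, smul_mul_assoc, smul_sub, smul_add]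
    abel
  rw [e2]
  simp only [map_add, map_smul, ← h1, ← h2, ← h3, ← h4, e, e', mul_smul]
  simp only [mul_add, add_mul, mul_smul_comm, smul_mul_assoc, smul_sub, smul_add]
  abel

end SmoothRep

end

section

variable {G : RealForm} (π : SmoothRep.{u} G)

/-! ### The tensor product with the natural representation -/

namespace SmoothRep

/-- The Leibniz rule: `g_ij ρ(g) u_j - δ_ij u_j` splits as `(g_ij - δ_ij) ρ(g) u_j` plus `δ_ij (ρ(g)
u_j - u_j)`. -/
theorem lieDeriv_tensorStd (A : G.lie) (u : Fin 2 → π.V) :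
    lieDeriv G (tensorStd G π.act) A u =
      fun i => π.diffAction A (u i) + ∑ j, (A : M2) i j • u j := by
  refine Tendsto.limUnder_eq (tendsto_pi_nhds.2 fun i => ?_)
  have h1 := π.tendsto_lieCLM A (u i)
  have h2 (j : Fin 2) : Tendsto (fun t : ℝ => π.ρ (expMap G.toClosedSubgroup (t • A)) (u j))
      (𝓝[≠] 0) (𝓝 (u j)) := by
    have := (π.continuous_action.comp
      ((continuous_expMap_smul A).prodMk (continuous_const (y := u j)))).tendsto 0
    simp only [Function.comp, zero_smul, expMap_zero, map_one, one_apply_eq_self] at this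
    exact this.mono_left nhdsWithin_le_nhds
  have h3 (j : Fin 2) := ((continuous_id.matrix_elem i j).tendsto (A : M2)).comp
    (tendsto_slope_matrix_exp (A : M2))
  have h4 := h1.add (tendsto_finsetSum Finset.univ fun j _ => (h3 j).smul (h2 j))
  rw [← diffAction_coe] at h4
  refine h4.congr fun t => ?_
  simp only [Function.comp, id, tensorStd, SmoothRep.act, coe_expMap, Submodule.coe_smul,
    Pi.smul_apply, Pi.sub_apply, Matrix.smul_apply, Matrix.sub_apply, smul_assoc, sub_smul,
    ← Finset.smul_sum, Finset.sum_sub_distrib, ← smul_add, Matrix.one_apply, ite_smul, one_smul,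
    zero_smul, Finset.sum_ite_eq, Finset.mem_univ, if_true]
  congr 1
  abel

theorem lieAction_tensorStd (Z : M2) (hZ : Z.trace = 0) (u : Fin 2 → π.V) :
    lieAction G (tensorStd G π.act) Z hZ u =
      fun i => π.diffAction Z (u i) + ∑ j, Z i j • u j := by
  set p := (G.existsUnique_add_I_smul Z hZ).choose with hp
  have e : Z = (p.1 : M2) + Complex.I • (p.2 : M2) :=
    (G.existsUnique_add_I_smul Z hZ).choose_spec.1
  have h : lieAction G (tensorStd G π.act) Z hZ u =
      lieDeriv G (tensorStd G π.act) p.1 u +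
        Complex.I • lieDeriv G (tensorStd G π.act) p.2 u := rfl
  rw [h, lieDeriv_tensorStd, lieDeriv_tensorStd]
  clear_value p
  subst e
  ext i
  simp only [Pi.add_apply, Pi.smul_apply, map_add, map_smul, add_apply, smul_apply,
    Matrix.add_apply, Matrix.smul_apply, Fin.sum_univ_two, smul_eq_mul]
  module

/-- The mixed part of the Casimir element of `π ⊗ ℂ²`. -/
def mixedCasimir (u : Fin 2 → π.V) : Fin 2 → π.V :=
  ![π.diffAction !![1, 0; 0, -1] (u 0) + (2 : ℂ) • π.diffAction !![0, 0; 1, 0] (u 1),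
    (2 : ℂ) • π.diffAction !![0, 1; 0, 0] (u 0) - π.diffAction !![1, 0; 0, -1] (u 1)]

variable {π}

theorem casimir_eq {μ : ℂ} (h : HasInfChar G π.act μ) (v : π.V) :
    π.diffAction !![1, 0; 0, -1] (π.diffAction !![1, 0; 0, -1] v) +
      (2 : ℂ) • (π.diffAction !![0, 1; 0, 0] (π.diffAction !![0, 0; 1, 0] v) +
        π.diffAction !![0, 0; 1, 0] (π.diffAction !![0, 1; 0, 0] v)) = (μ ^ 2 - 1) • v := by
  rw [← h v, casimir, opH, opX, opY]
  simp only [π.diffAction_apply_eq_lieAction _ (by simp [Matrix.trace_fin_two] :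
      (!![1, 0; 0, -1] : M2).trace = 0),
    π.diffAction_apply_eq_lieAction _ (by simp [Matrix.trace_fin_two] :
      (!![0, 1; 0, 0] : M2).trace = 0),
    π.diffAction_apply_eq_lieAction _ (by simp [Matrix.trace_fin_two] :
      (!![0, 0; 1, 0] : M2).trace = 0)]

/-- The coproduct of `Ω` is `Ω⊗1 + 1⊗Ω` plus twice the mixed part, and `Ω` acts on `ℂ²` by `2² - 1 =
3`. -/
theorem casimir_tensorStd {μ : ℂ} (h : HasInfChar G π.act μ) (u : Fin 2 → π.V) :
    casimir G (tensorStd G π.act) u = (μ ^ 2 + 2) • u + (2 : ℂ) • π.mixedCasimir u := by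
  have h0 := casimir_eq h (u 0)
  have h1 := casimir_eq h (u 1)
  ext i
  simp only [casimir, opH, opX, opY, lieAction_tensorStd]
  fin_cases i
  · simp [Fin.sum_univ_two, mixedCasimir]
    linear_combination (norm := module) h0
  · simp [Fin.sum_univ_two, mixedCasimir]
    linear_combination (norm := module) h1

variable (π) in
theorem diffAction_comm_apply {Z W : M2} (hZ : Z.trace = 0) (hW : W.trace = 0) (v : π.V) :
    π.diffAction Z (π.diffAction W v) =
      π.diffAction W (π.diffAction Z v) + π.diffAction (Z * W - W * Z) v := by
  rw [← π.diffAction_comm hZ hW, sub_apply, mul_apply_eq_comp, mul_apply_eq_comp]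
  abel

/-- Equivalently `(M + 1)² = μ²`: the roots `-1 ± μ` of `M` correspond to the infinitesimal
characters `μ ± 1`. Only the `𝔰𝔩₂` relations and the scalar action of `Ω` enter. -/
theorem mixedCasimir_quadratic {μ : ℂ} (h : HasInfChar G π.act μ) (u : Fin 2 → π.V) :
    π.mixedCasimir (π.mixedCasimir u) = (μ ^ 2 - 1) • u - (2 : ℂ) • π.mixedCasimir u := by
  have h0 := casimir_eq h (u 0)
  have h1 := casimir_eq h (u 1)
  have e1 : (!![1, 0; 0, -1] : M2) * !![0, 1; 0, 0] - !![0, 1; 0, 0] * !![1, 0; 0, -1] =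
      (2 : ℂ) • !![0, 1; 0, 0] := by
    ext i j; fin_cases i <;> fin_cases j <;> simp; norm_num
  have e2 : (!![1, 0; 0, -1] : M2) * !![0, 0; 1, 0] - !![0, 0; 1, 0] * !![1, 0; 0, -1] =
      (-2 : ℂ) • !![0, 0; 1, 0] := by
    ext i j; fin_cases i <;> fin_cases j <;> simp; norm_num
  have e3 : (!![0, 1; 0, 0] : M2) * !![0, 0; 1, 0] - !![0, 0; 1, 0] * !![0, 1; 0, 0] =
      !![1, 0; 0, -1] := by
    ext i j; fin_cases i <;> fin_cases j <;> simp
  have c1 (v : π.V) := π.diffAction_comm_apply (Z := !![1, 0; 0, -1]) (W := !![0, 1; 0, 0])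
    (by simp [Matrix.trace_fin_two]) (by simp [Matrix.trace_fin_two]) v
  have c2 (v : π.V) := π.diffAction_comm_apply (Z := !![1, 0; 0, -1]) (W := !![0, 0; 1, 0])
    (by simp [Matrix.trace_fin_two]) (by simp [Matrix.trace_fin_two]) v
  have c3 (v : π.V) := π.diffAction_comm_apply (Z := !![0, 1; 0, 0]) (W := !![0, 0; 1, 0])
    (by simp [Matrix.trace_fin_two]) (by simp [Matrix.trace_fin_two]) v
  rw [e1] at c1
  rw [e2] at c2
  rw [e3] at c3
  simp only [map_smul, smul_apply] at c1 c2
  rw [c3] at h0 h1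
  ext i
  fin_cases i
  · simp only [mixedCasimir, Fin.zero_eta, Matrix.cons_val_zero, Matrix.cons_val_one,
      Pi.sub_apply, Pi.smul_apply, map_add, map_sub, map_smul, c1, c2, c3]
    linear_combination (norm := module) h0
  · simp only [mixedCasimir, Fin.mk_one, Matrix.cons_val_zero, Matrix.cons_val_one,
      Pi.sub_apply, Pi.smul_apply, map_add, map_sub, map_smul, c1, c2, c3]
    linear_combination (norm := module) h1

/-- The range of the projection of `π ⊗ ℂ²` to its primary component `P_{μ + δ}`. -/
theorem mem_primaryComponent_tensorStd {μ δ : ℂ} (h : HasInfChar G π.act μ) (hδ : δ ^ 2 = 1)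
    (u : Fin 2 → π.V) :
    π.mixedCasimir u + (1 + δ * μ) • u ∈
      primaryComponent G (tensorStd G π.act) (μ + δ) := by
  -- One power suffices: `Ω - ((μ + δ)² - 1) = 2(M + 1 - δμ)`, and this annihilates the image of `M
  -- + 1 + δμ`.
  refine ⟨1, ?_⟩
  have hadd (x : Fin 2 → π.V) (a : ℂ) : π.mixedCasimir (π.mixedCasimir x + a • x) =
      π.mixedCasimir (π.mixedCasimir x) + a • π.mixedCasimir x := by
    ext i
    fin_cases i
    · simp [mixedCasimir]; module
    · simp [mixedCasimir]; module
  rw [Function.iterate_one, casimir_tensorStd h, hadd, mixedCasimir_quadratic h]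
  match_scalars
  · linear_combination -hδ
  · linear_combination -(1 + μ * δ + 2 * μ ^ 2) * hδ

end SmoothRep

end

section

/-! ### The subgroup `G'` and its characters -/

theorem IsTriple.trace_eq_zero {H X Y : M2} (h : IsTriple H X Y) : H.trace = 0 := by
  rw [← h.comm_XY, Matrix.trace_sub, Matrix.trace_mul_comm, sub_self]

/-- The scalar `w` need not be real, so compact and split `G'` are treated together. -/
theorem exists_smul_mem_lieAlg {G' : ClosedSubgroup SL2C} {H : M2} (hH : H ≠ 0)
    (hG' : Submodule.span ℂ (lieAlg G' : Set M2) = Submodule.span ℂ {H}) :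
    ∃ w : ℂ, w ≠ 0 ∧ w • H ∈ lieAlg G' := by
  have hex : ∃ A ∈ lieAlg G', A ≠ 0 := by
    by_contra! h0
    have h1 : H ∈ Submodule.span ℂ (lieAlg G' : Set M2) :=
      hG' ▸ Submodule.mem_span_singleton_self H
    have h2 : Submodule.span ℂ (lieAlg G' : Set M2) = ⊥ := Submodule.span_eq_bot.2 h0
    rw [h2, Submodule.mem_bot] at h1
    exact hH h1
  obtain ⟨A, hA, hA0⟩ := hex
  have h1 : A ∈ Submodule.span ℂ (lieAlg G' : Set M2) := Submodule.subset_span hA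
  rw [hG', Submodule.mem_span_singleton] at h1
  obtain ⟨w, rfl⟩ := h1
  exact ⟨w, fun h => hA0 (by rw [h, zero_smul]), hA⟩

theorem coe_inv_mul_coe (g : SL2C) : ((g⁻¹ : SL2C) : M2) * (g : M2) = 1 := by
  rw [← Matrix.SpecialLinearGroup.coe_mul, inv_mul_cancel, Matrix.SpecialLinearGroup.coe_one]

/-- A connected closed subgroup whose complexified Lie algebra is `ℂ H` centralizes `H`. -/
theorem commute_of_isConnected {G' : ClosedSubgroup SL2C}
    (hconn : IsConnected (G'.toSubgroup : Set SL2C)) {H X Y : M2} (htriple : IsTriple H X Y)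
    (hG' : Submodule.span ℂ (lieAlg G' : Set M2) = Submodule.span ℂ {H})
    {g : SL2C} (hg : g ∈ G'.toSubgroup) : (g : M2) * H = H * g := by
  obtain ⟨w, hw, hwH⟩ := exists_smul_mem_lieAlg htriple.ne_zero hG'
  have hsq := htriple.sq_eq_one
  have hconj (k : SL2C) (hk : k ∈ G'.toSubgroup) :
      ∃ c : ℂ, (k : M2) * H * ((k⁻¹ : SL2C) : M2) = c • H := by
    have h1 : _ ∈ Submodule.span ℂ (lieAlg G' : Set M2) :=
      Submodule.subset_span (conj_mem_lieAlg hk hwH)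
    rw [hG', Submodule.mem_span_singleton] at h1
    obtain ⟨a, ha⟩ := h1
    refine ⟨w⁻¹ * a, ?_⟩
    rw [mul_smul, ha, mul_smul_comm, smul_mul_assoc, inv_smul_smul₀ hw]
  -- On `G'`, `Ad(k)H = cH`, and `f` reads off `c` continuously. Since `H² = 1` forces `c² = 1`,
  -- connectedness and `f 1 = 1` give `c = 1`.
  set f : SL2C → ℂ := fun k =>
    ((k : M2) * H * ((k⁻¹ : SL2C) : M2) * H).trace / 2 with hf
  have hfc (k : SL2C) (c : ℂ) (h : (k : M2) * H * ((k⁻¹ : SL2C) : M2) = c • H) : f k = c := by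
    simp only [hf, h]
    simp [hsq]
  have hfcont : Continuous f := by
    have h1 : Continuous fun k : SL2C => ((k⁻¹ : SL2C) : M2) :=
      continuous_coe_SL2C.comp continuous_inv
    have h2 := ((continuous_coe_SL2C.mul (continuous_const (y := H))).mul h1).mul
      (continuous_const (y := H))
    exact h2.matrix_trace.div_const 2
  have hfsq : Set.EqOn (f ^ 2) 1 (G'.toSubgroup : Set SL2C) := by
    intro k hk
    obtain ⟨c, hc⟩ := hconj k hk
    have h1 : ((k : M2) * H * ((k⁻¹ : SL2C) : M2)) * ((k : M2) * H * ((k⁻¹ : SL2C) : M2)) = 1 := by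
      have := coe_inv_mul_coe k⁻¹
      rw [inv_inv] at this
      calc _ = (k : M2) * H * (((k⁻¹ : SL2C) : M2) * (k : M2)) * H * ((k⁻¹ : SL2C) : M2) := by
            noncomm_ring
        _ = (k : M2) * (H * H) * ((k⁻¹ : SL2C) : M2) := by
            rw [coe_inv_mul_coe]; noncomm_ring
        _ = 1 := by rw [hsq, mul_one, this]
    rw [hc, smul_mul_smul_comm, hsq] at h1
    have h2 := congrFun (congrFun h1 0) 0
    simp only [Matrix.smul_apply, Matrix.one_apply_eq, smul_eq_mul, mul_one] at h2
    simp [hfc k c hc, sq, h2]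
  have hf1 : f 1 = 1 := hfc 1 1 (by simp)
  have hfg : f g = 1 := by
    rcases hconn.isPreconnected.eq_one_or_eq_neg_one_of_sq_eq hfcont.continuousOn hfsq with h | h
    · exact h hg
    · have := h (one_mem G'.toSubgroup)
      rw [hf1] at this
      norm_num at this
  obtain ⟨c, hc⟩ := hconj g hg
  rw [← hfc g c hc, hfg, one_smul] at hc
  rw [← hc, mul_assoc _ _ (g : M2), coe_inv_mul_coe, mul_one, hc]

/-- The projections to the eigenlines of `H` have rank one. -/
theorem IsTriple.exists_rank_one {H X Y : M2} (h : IsTriple H X Y) {s : ℂ} (hs : s ^ 2 = 1) :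
    ∃ c e : Fin 2 → ℂ, (∀ i j, ((1 / 2 : ℂ) • (1 + s • H)) i j = c i * e j) ∧
      e 0 * c 0 + e 1 * c 1 = 1 := by
  have hsq := h.sq_eq_one
  have htr := h.trace_eq_zero
  rw [Matrix.trace_fin_two] at htr
  have hdet : H 0 0 * H 1 1 - H 0 1 * H 1 0 = -1 := by
    have := congrFun (congrFun hsq 0) 0
    simp only [Matrix.mul_apply, Fin.sum_univ_two, Matrix.one_apply_eq] at this
    linear_combination -this + H 0 0 * htr
  set P : M2 := (1 / 2 : ℂ) • (1 + s • H) with hP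
  have htrP : P 0 0 + P 1 1 = 1 := by
    simp [hP]
    linear_combination s / 2 * htr
  have hdetP : P 0 0 * P 1 1 = P 0 1 * P 1 0 := by
    simp [hP]
    linear_combination s / 4 * htr + s ^ 2 / 4 * hdet - hs / 4
  clear_value P
  -- A matrix of trace `1` and determinant `0` factors as column times row. The pivot is whichever
  -- diagonal entry is known to be nonzero, and `e · c` is the trace.
  by_cases h0 : P 0 0 = 0
  · have h1 : P 1 1 = 1 := by simpa [h0] using htrP
    refine ⟨![P 0 1, 1], ![P 1 0, P 1 1], fun i j => ?_, ?_⟩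
    · fin_cases i <;> fin_cases j <;> simp [h1, h0]
      simpa [h0] using hdetP.symm
    · simp
      linear_combination -hdetP + htrP + h0 * (P 1 1 - 1)
  · refine ⟨![1, P 1 0 / P 0 0], ![P 0 0, P 0 1], fun i j => ?_, ?_⟩
    · fin_cases i <;> fin_cases j <;> simp
      · field_simp
      · field_simp
        linear_combination hdetP
    · simp
      field_simp
      linear_combination P 0 0 * htrP - hdetP

/-- The rank-one projection `P` commutes with `g`, so `Pg = PgP`, and `PgP = tr(gP) P` for any `g`.
-/
theorem IsTriple.trace_mul_proj {H X Y : M2} (h : IsTriple H X Y) {g : SL2C}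
    (hg : (g : M2) * H = H * g) {s : ℂ} (hs : s ^ 2 = 1) :
    ((1 / 2 : ℂ) • (1 + s • H)) * (g : M2) =
      ((g : M2) * ((1 / 2 : ℂ) • (1 + s • H))).trace • ((1 / 2 : ℂ) • (1 + s • H)) := by
  obtain ⟨c, e, hce, he⟩ := h.exists_rank_one hs
  set P : M2 := (1 / 2 : ℂ) • (1 + s • H) with hP
  have hPP : P * P = P := by
    ext i j
    simp only [Matrix.mul_apply, Fin.sum_univ_two, hce]
    linear_combination c i * e j * he
  have hgP : (g : M2) * P = P * g := by
    simp [hP, mul_add, add_mul, hg]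
  calc P * (g : M2) = P * P * g := by rw [hPP]
    _ = P * g * P := by rw [mul_assoc P (g : M2) P, hgP, ← mul_assoc]
    _ = _ := by
      ext i j
      simp only [Matrix.mul_apply, Fin.sum_univ_two, hce, Matrix.smul_apply, smul_eq_mul,
        Matrix.trace_fin_two]
      ring

/-- The two traces are the eigenvalues of `g` on the eigenlines of `H`, so their product is `det g`.
-/
theorem IsTriple.trace_mul_trace {H X Y : M2} (h : IsTriple H X Y) {g : SL2C}
    (hg : (g : M2) * H = H * g) :
    ((g : M2) * ((1 / 2 : ℂ) • (1 + (1 : ℂ) • H))).trace *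
      ((g : M2) * ((1 / 2 : ℂ) • (1 + (-1 : ℂ) • H))).trace = 1 := by
  have h1 := h.trace_mul_proj hg (s := 1) (by norm_num)
  have h2 := h.trace_mul_proj hg (s := -1) (by norm_num)
  set a := ((g : M2) * ((1 / 2 : ℂ) • (1 + (1 : ℂ) • H))).trace
  set b := ((g : M2) * ((1 / 2 : ℂ) • (1 + (-1 : ℂ) • H))).trace
  have hsum : (g : M2) = ((a + b) / 2) • 1 + ((a - b) / 2) • H := by
    calc (g : M2) = ((1 / 2 : ℂ) • (1 + (1 : ℂ) • H)) * (g : M2) +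
          ((1 / 2 : ℂ) • (1 + (-1 : ℂ) • H)) * (g : M2) := by
          rw [← add_mul, ← smul_add]
          have : (1 : M2) + (1 : ℂ) • H + (1 + (-1 : ℂ) • H) = (2 : ℂ) • 1 := by module
          rw [this]
          simp
      _ = _ := by
          rw [h1, h2]
          module
  have hd := g.2
  have htr := h.trace_eq_zero
  rw [Matrix.trace_fin_two] at htr
  have hdet : H 0 0 * H 1 1 - H 0 1 * H 1 0 = -1 := by
    have := congrFun (congrFun h.sq_eq_one 0) 0
    simp only [Matrix.mul_apply, Fin.sum_univ_two, Matrix.one_apply_eq] at this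
    linear_combination -this + H 0 0 * htr
  rw [hsum, Matrix.det_fin_two] at hd
  simp at hd
  linear_combination hd - (a + b) / 2 * ((a - b) / 2) * htr - ((a - b) / 2) ^ 2 * hdet

/-- The action of `g` on the eigenfunctionals of `H` of weight `s = ± 1`. -/
theorem IsTriple.weightChar_eigen {H X Y : M2} (h : IsTriple H X Y) {g : SL2C}
    (hg : (g : M2) * H = H * g) {s : ℤ} (hs : s = 1 ∨ s = -1) (c e : Fin 2 → ℂ)
    (hce : ∀ i j, ((1 / 2 : ℂ) • (1 + (s : ℂ) • H)) i j = c i * e j)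
    (he : e 0 * c 0 + e 1 * c 1 = 1) (ν : ℤ) (k : Fin 2) :
    weightChar H ν g * (∑ i, e i * (g : M2) i k) = weightChar H (ν + s) g * e k := by
  have hs2 : (s : ℂ) ^ 2 = 1 := by rcases hs with rfl | rfl <;> norm_num
  have h1 := h.trace_mul_proj hg hs2
  have h2 := h.trace_mul_trace hg
  set a := ((g : M2) * ((1 / 2 : ℂ) • (1 + (1 : ℂ) • H))).trace with ha
  have ha0 : a ≠ 0 := left_ne_zero_of_mul_eq_one h2
  have hw (n : ℤ) : weightChar H n g = a ^ n := by rw [weightChar, ha, one_smul]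
  have hs' : ((g : M2) * ((1 / 2 : ℂ) • (1 + (s : ℂ) • H))).trace = a ^ s := by
    rcases hs with rfl | rfl
    · simp [ha]
    · rw [zpow_neg_one]
      push_cast
      exact eq_inv_of_mul_eq_one_right h2
  rw [hs'] at h1
  have h3 (l : Fin 2) : c l * ∑ i, e i * (g : M2) i k = c l * (a ^ s * e k) := by
    have := congrFun (congrFun h1 l) k
    simp only [Matrix.mul_apply, hce] at this
    rw [Finset.mul_sum]
    simp only [Matrix.smul_apply, hce, smul_eq_mul] at this
    simp only [← mul_assoc, this]
    ring
  -- The matrix identity gives this only up to the factors `c l`; contracting with `e` and using `e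
  -- · c = 1` removes them.
  have h4 : ∑ i, e i * (g : M2) i k = a ^ s * e k := by
    have h5 := h3 0
    have h6 := h3 1
    linear_combination e 0 * h5 + e 1 * h6 - (∑ i, e i * (g : M2) i k - a ^ s * e k) * he
  rw [h4, hw, hw, zpow_add₀ ha0]
  ring

/-! ### Translation of symmetry breaking operators -/

variable {G : RealForm} {G' : ClosedSubgroup SL2C} {hle : G'.toSubgroup ≤ G.toSubgroup}
  {H X Y : M2}

/-- Differentiate the equivariance along `exp(t w H)` and cancel `w ≠ 0`. -/
theorem symmetryBreaking_diffAction (htriple : IsTriple H X Y)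
    (hG' : Submodule.span ℂ (lieAlg G' : Set M2) = Submodule.span ℂ {H})
    (π : SmoothRep.{u} G) {ν : ℤ} {T : π.V →L[ℂ] ℂ}
    (hT : T ∈ symmetryBreaking G'.toSubgroup hle H π ν) (v : π.V) :
    T (π.diffAction H v) = ν * T v := by
  obtain ⟨w, hw, hwH⟩ := exists_smul_mem_lieAlg htriple.ne_zero hG'
  have hmem : w • H ∈ G.lie := fun t => by
    obtain ⟨g, hg, h⟩ := hwH t
    exact ⟨g, hle hg, h⟩
  have h1 := (T.continuous.tendsto _).comp (π.tendsto_lieCLM ⟨_, hmem⟩ v)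
  rw [← π.diffAction_coe] at h1
  have h2 : HasDerivAt (fun t : ℝ => Complex.exp (ν * (t * w)) * T v) (ν * w * T v) 0 := by
    have h3 : HasDerivAt (fun t : ℝ => ν * ((t : ℂ) * w)) (ν * w) 0 := by
      simpa using ((Complex.ofRealCLM.hasDerivAt (x := 0)).mul_const w).const_mul (ν : ℂ)
    simpa using h3.cexp.mul_const (T v)
  rw [hasDerivAt_iff_tendsto_slope_zero] at h2
  have h4 : T (π.diffAction (w • H) v) = ν * w * T v := by
    refine tendsto_nhds_unique h1 (h2.congr fun t => ?_)
    obtain ⟨g, hg, h⟩ := hwH t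
    have h5 : expMap G.toClosedSubgroup (t • ⟨w • H, hmem⟩) = ⟨g, hle hg⟩ :=
      expMap_injective_coe h
    have h6 : weightChar H ν g = Complex.exp (ν * (t * w)) :=
      weightChar_exp htriple ν _ g (by rw [h, mul_smul]; rfl)
    rw [Function.comp_apply, h5, ContinuousLinearMap.map_smul_of_tower, map_sub, hT g hg, h6]
    simp
  rw [map_smul, smul_apply, map_smul, smul_eq_mul] at h4
  exact mul_left_cancel₀ hw (by linear_combination h4)

theorem SmoothRep.diffAction_eq_sum (π : SmoothRep.{u} G) (Z : M2) :
    π.diffAction Z = ((Z 0 0 - Z 1 1) / 2) • π.diffAction !![1, 0; 0, -1] +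
      Z 0 1 • π.diffAction !![0, 1; 0, 0] + Z 1 0 • π.diffAction !![0, 0; 1, 0] := by
  simp only [SmoothRep.diffAction_eq_cplxCLM _ !![1, 0; 0, -1] (by simp [Matrix.trace_fin_two]),
    SmoothRep.diffAction_eq_cplxCLM _ !![0, 1; 0, 0] (by simp [Matrix.trace_fin_two]),
    SmoothRep.diffAction_eq_cplxCLM _ !![0, 0; 1, 0] (by simp [Matrix.trace_fin_two])]
  rfl

theorem SmoothRep.diffAction_one (π : SmoothRep.{u} G) : π.diffAction 1 = 0 := by
  rw [diffAction_eq_sum]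
  simp

/-- The multiplicity does not decrease under a translation that avoids the wall. -/
theorem sbMultiplicity_le (hconn : IsConnected (G'.toSubgroup : Set SL2C))
    (htriple : IsTriple H X Y)
    (hG' : Submodule.span ℂ (lieAlg G' : Set M2) = Submodule.span ℂ {H})
    {π π' : SmoothRep.{u} G} {μ δ : ℂ} (hμ : HasInfChar G π.act μ) (hδ : δ ^ 2 = 1)
    (hiso : PrimaryIso π (μ + δ) π') {s : ℤ} (hs : s = 1 ∨ s = -1) (ν : ℤ)
    (hne : s * ν + δ * μ + 1 ≠ 0) :
    sbMultiplicity G'.toSubgroup hle H π ν ≤ sbMultiplicity G'.toSubgroup hle H π' (ν + s) := by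
  have hs2 : (s : ℂ) ^ 2 = 1 := by rcases hs with rfl | rfl <;> norm_num
  obtain ⟨c, e, hce, he⟩ := htriple.exists_rank_one hs2
  obtain ⟨j, -, hj, hjg⟩ := hiso
  -- This is `T ↦ (T ⊗ e) ∘ j`.
  let Φ₀ : (π.V →L[ℂ] ℂ) →ₗ[ℂ] (π'.V →L[ℂ] ℂ) :=
    { toFun T := ∑ i, e i • (T ∘L (ContinuousLinearMap.proj i ∘L j))
      map_add' S T := by ext v; simp; ring
      map_smul' a T := by ext v; simp; ring }
  have hΦ₀ (T : π.V →L[ℂ] ℂ) (v : π'.V) : Φ₀ T v = ∑ i, e i * T (j v i) := by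
    simp [Φ₀]
  have hmem : ∀ T ∈ symmetryBreaking G'.toSubgroup hle H π ν,
      Φ₀ T ∈ symmetryBreaking G'.toSubgroup hle H π' (ν + s) := by
    intro T hT g hg v
    have hc := commute_of_isConnected hconn htriple hG' hg
    have hk := htriple.weightChar_eigen hc hs c e hce he ν
    have h1 : j (π'.ρ ⟨g, hle hg⟩ v) = tensorStd G π.act ⟨g, hle hg⟩ (j v) := hjg _ _
    have hk0 := hk 0
    have hk1 := hk 1
    simp only [Fin.sum_univ_two] at hk0 hk1
    simp only [hΦ₀, h1, tensorStd, SmoothRep.act, map_add, map_smul, smul_eq_mul,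
      Fin.sum_univ_two, hT g hg]
    linear_combination T (j v 0) * hk0 + T (j v 1) * hk1
  refine LinearMap.rank_le_of_injective (Φ₀.restrict hmem) ?_
  refine (injective_iff_map_eq_zero _).2 ?_
  rintro ⟨T, hT⟩ h0
  have h0 : Φ₀ T = 0 := congrArg Subtype.val h0
  ext v
  -- The test vector `(M + 1 + δμ)(v ⊗ c)` lies in the primary component, hence in the range of `j`,
  -- where `T ⊗ e` vanishes.
  have hw := SmoothRep.mem_primaryComponent_tensorStd hμ hδ (fun i => c i • v)
  rw [← hj] at hw
  obtain ⟨w, hw⟩ := hw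
  have h1 := hΦ₀ T w
  rw [h0, hw] at h1
  have h2 := symmetryBreaking_diffAction htriple hG' π hT v
  have hHs : π.diffAction (((1 / 2 : ℂ) • (1 + (s : ℂ) • H))) v =
      (1 / 2 * s : ℂ) • π.diffAction H v := by
    rw [map_smul, map_add, map_smul, π.diffAction_one, zero_add, smul_smul, smul_apply]
  have h3 : T (π.diffAction ((1 / 2 : ℂ) • (1 + (s : ℂ) • H)) v) = 1 / 2 * s * (ν * T v) := by
    rw [hHs, map_smul, h2, smul_eq_mul]
  -- The products `c i * e j` reassemble the eigenprojection of `H`, so contracting `M` with `e` and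
  -- `c` gives twice the action of that projection.
  have h4 : ∑ i, e i * T ((π.mixedCasimir (fun i => c i • v) + (1 + δ * μ) • fun i => c i • v) i) =
      2 * T (π.diffAction ((1 / 2 : ℂ) • (1 + (s : ℂ) • H)) v) + (1 + δ * μ) * T v := by
    rw [π.diffAction_eq_sum]
    simp only [hce, SmoothRep.mixedCasimir, Fin.sum_univ_two, Pi.add_apply, Pi.smul_apply,
      Matrix.cons_val_zero, Matrix.cons_val_one, map_add, map_sub, map_smul, smul_eq_mul]
    simp only [add_apply, smul_apply, map_add, map_smul, smul_eq_mul]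
    linear_combination (1 + δ * μ) * T v * he
  rw [h4, h3] at h1
  have h5 : (s * ν + δ * μ + 1) * T v = 0 := by
    simp at h1
    linear_combination -h1
  simpa using (mul_eq_zero.1 h5).resolve_left hne

end

/-! ### Walks in the parameter space -/

/-- Steps along the main diagonal make `M` a function of `l - ν`; two steps lowering `l` with
opposite changes of `ν` make that function 2-periodic. -/
theorem eq_of_parity_of_steps {α : Type*} {M : ℤ → ℤ → α}
    (hM : ∀ d s : ℤ, (d = 1 ∨ d = -1) → (s = 1 ∨ s = -1) → ∀ l ν, M l ν = M (l + d) (ν + s))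
    (l ν : ℤ) : M l ν = M (((l - ν : ℤ) : ZMod 2).val : ℤ) 0 := by
  have h1 : ∀ ν l : ℤ, M l ν = M (l - ν) 0 := by
    intro ν
    induction ν with
    | zero => simp
    | succ n ih =>
      intro l
      rw [hM (-1) (-1) (by simp) (by simp), add_neg_cancel_right, ih]
      congr 1
      ring
    | pred n ih =>
      intro l
      rw [hM 1 1 (by simp) (by simp), sub_add_cancel, ih]
      congr 1
      ring
  have h2 : Function.Periodic (fun n => M n 0) 2 := by
    intro n
    have := hM (-1) 1 (by simp) (by simp) (n + 2) 0
    have h3 := hM (-1) (-1) (by simp) (by simp) (n + 2 + -1) (0 + 1)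
    simp only
    rw [this, h3]
    congr 1
    ring
  rw [h1, ZMod.val_intCast]
  have := h2.int_mul ((l - ν) / 2) ((l - ν) % 2)
  rw [Nat.cast_ofNat, ← this]
  congr 1
  have := Int.emod_add_mul_ediv (l - ν) 2
  simp only [Int.cast_id]
  linarith

section Walk

variable {α : Type*} {M : ℤ → ℤ → α}

/-- Invariance of `M` under the diagonal moves in `ℕ₊ × ℤ` that avoid the walls. -/
def IsStepInvariant (M : ℤ → ℤ → α) : Prop :=
  ∀ d s : ℤ, (d = 1 ∨ d = -1) → (s = 1 ∨ s = -1) → ∀ l ν : ℤ, 0 < l → 0 < l + d →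
    s * ν + d * l + 1 ≠ 0 → M l ν = M (l + d) (ν + s)

theorem IsStepInvariant.eq_of_step (hM : IsStepInvariant M) {l ν l' ν' : ℤ} (d s : ℤ)
    (hd : d = 1 ∨ d = -1) (hs : s = 1 ∨ s = -1) (h : 0 < l) (hl : l + d = l') (hν : ν + s = ν')
    (h' : 0 < l') (hne : s * ν + d * l + 1 ≠ 0) : M l ν = M l' ν' := by
  subst hl hν
  exact hM d s hd hs l ν h h' hne

/-- Here `s * ν + d * l + 1` is always odd, so no step is blocked: descend diagonally to `l = 1`,
then move along that row. -/
theorem IsStepInvariant.eq_of_even (hM : IsStepInvariant M) (n : ℕ) (ν : ℤ)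
    (h : ∃ k : ℤ, ν = n + 1 + 2 * k) : M (n + 1) ν = M 1 1 := by
  induction n generalizing ν with
  | zero =>
    -- The row `l = 0` is unavailable, so `ν` changes by `2` through the row `l = 2`.
    have step (k : ℤ) : M 1 (1 + 2 * (k + 1)) = M 1 (1 + 2 * k) :=
      (hM.eq_of_step (l' := 2) (ν' := 2 + 2 * k) 1 (-1) (by simp) (by simp) (by simp) (by ring)
        (by ring) (by simp) (by omega)).trans
        (hM.eq_of_step (-1) (-1) (by simp) (by simp) (by simp) (by ring) (by ring) (by simp)
          (by omega))
    obtain ⟨k, rfl⟩ := h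
    simp only [Nat.cast_zero, zero_add]
    induction k with
    | zero => simp
    | succ k ih => rw [step, ih]
    | pred k ih => rw [← ih, ← step, sub_add_cancel]
  | succ n ih =>
    obtain ⟨k, rfl⟩ := h
    rw [← ih (n + 1 + 2 * k) ⟨k, rfl⟩]
    push_cast
    exact hM.eq_of_step (-1) (-1) (by simp) (by simp) (by omega) (by ring) (by ring) (by omega)
      (by omega)

/-- Same walk as in the even case; `k ≥ 0` keeps it above the wall `ν = l`. -/
theorem IsStepInvariant.eq_of_up (hM : IsStepInvariant M) (n k : ℕ) :
    M (n + 1) (n + 2 + 2 * k) = M 1 2 := by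
  induction n with
  | zero =>
    simp only [Nat.cast_zero, zero_add]
    induction k with
    | zero => simp
    | succ k ih =>
      rw [← ih]
      exact (hM.eq_of_step (l' := 2) (ν' := 3 + 2 * k) 1 (-1) (by simp) (by simp) (by simp)
        (by ring) (by push_cast; ring) (by simp) (by omega)).trans
        (hM.eq_of_step (-1) (-1) (by simp) (by simp) (by simp) (by ring) (by ring) (by simp)
          (by omega))
  | succ n ih =>
    rw [← ih]
    push_cast
    exact hM.eq_of_step (-1) (-1) (by simp) (by simp) (by omega) (by ring) (by ring) (by omega)
      (by omega)

/-- The reflection `ν ↦ -ν` exchanges the upper and lower odd regions, so only one of them needs a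
walk. -/
theorem IsStepInvariant.neg (hM : IsStepInvariant M) :
    IsStepInvariant fun l ν => M l (-ν) := by
  intro d s hd hs l ν h h' hne
  refine hM.eq_of_step d (-s) hd (by omega) h rfl (by ring) h' ?_
  rwa [neg_mul_neg]

/-- Lower `l` while moving `ν` towards `0`, which stays inside the cone. At `ν = 0` the step goes to
`ν = 1`; parity then forces `n ≥ 1`, so the bound survives. -/
theorem IsStepInvariant.eq_of_right (hM : IsStepInvariant M) (n : ℕ) (ν : ℤ) (h : |ν| ≤ n)
    (hp : ∃ k : ℤ, ν = n + 2 * k) : M (n + 1) ν = M 1 0 := by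
  induction n generalizing ν with
  | zero =>
    have : ν = 0 := by simpa using h
    simp [this]
  | succ n ih =>
    obtain ⟨k, hk⟩ := hp
    rw [abs_le] at h
    push_cast at h hk ⊢
    rcases lt_or_ge 0 ν with h0 | h0
    · rw [← ih (ν - 1) (abs_le.2 (by omega)) ⟨k, by omega⟩]
      exact hM.eq_of_step (-1) (-1) (by simp) (by simp) (by omega) (by ring) (by ring) (by omega)
        (by omega)
    · rw [← ih (ν + 1) (abs_le.2 (by omega)) ⟨k + 1, by omega⟩]
      exact hM.eq_of_step (-1) 1 (by simp) (by simp) (by omega) (by ring) (by ring) (by omega)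
        (by omega)

end Walk

/-! ### Stability of multiplicities -/

theorem sbMultiplicity_eq {G : RealForm} {G' : ClosedSubgroup SL2C}
    {hle : G'.toSubgroup ≤ G.toSubgroup} {H X Y : M2}
    (hconn : IsConnected (G'.toSubgroup : Set SL2C)) (htriple : IsTriple H X Y)
    (hG' : Submodule.span ℂ (lieAlg G' : Set M2) = Submodule.span ℂ {H})
    {ξ : ℂ} {π : SmoothRep.{u} G} {P : paramSet ξ → SmoothRep.{u} G}
    (hP : IsReducedCoherentFamily π ξ P) {d s : ℤ} (hd : d = 1 ∨ d = -1) (hs : s = 1 ∨ s = -1)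
    {l l' : paramSet ξ} (hl : (l' : ℂ) = l + d) (ν : ℤ) (hne : (s * ν + d * l + 1 : ℂ) ≠ 0) :
    sbMultiplicity G'.toSubgroup hle H (P l) ν =
      sbMultiplicity G'.toSubgroup hle H (P l') (ν + s) := by
  have hd2 : (d : ℂ) ^ 2 = 1 := by rcases hd with rfl | rfl <;> norm_num
  have hs2 : (s : ℂ) ^ 2 = 1 := by rcases hs with rfl | rfl <;> norm_num
  obtain ⟨h1, h2⟩ := hP.coherent d (by rcases hd with rfl | rfl <;> simp) l l' hl
  refine le_antisymm (sbMultiplicity_le hconn htriple hG' (hP.infChar l) hd2 h1 hs ν hne) ?_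
  have hl2 : (l : ℂ) = l' + -d := by rw [hl]; ring
  rw [hl2] at h2
  -- The reverse factor `-s(ν + s) - d(l + d) + 1` equals `-(sν + dl + 1)` because `s² = d² = 1`.
  have h3 := sbMultiplicity_le (hle := hle) hconn htriple hG' (hP.infChar l')
    (by rw [neg_sq, hd2]) h2 (s := -s) (by omega) (ν + s) (by
      intro h0
      apply hne
      rw [hl] at h0
      push_cast at h0
      linear_combination -h0 - hs2 - hd2)
  rwa [add_neg_cancel_right] at h3

theorem mem_paramSet_of_pos {ξ : ℂ} (hξ : ∃ n : ℕ, 0 < n ∧ ξ = n) {l : ℂ} :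
    l ∈ paramSet ξ ↔ ∃ m : ℤ, 0 < m ∧ l = m := by
  obtain ⟨n, hn, rfl⟩ := hξ
  constructor
  · rintro (⟨h, -⟩ | ⟨-, h⟩ | ⟨⟨m, hm, h⟩, -⟩)
    · exact absurd (Int.cast_natCast n).symm (h n)
    · exact h
    · have : (n : ℤ) = m := by exact_mod_cast h
      omega
  · exact fun h => Or.inr (Or.inl ⟨⟨n, by omega, by simp⟩, h⟩)

/-! ### Integer descriptions of the regions -/

section Regions

variable {ξ : ℂ}

theorem mem_evenRegion_iff {p : paramSet ξ × ℤ} {m : ℤ} (hm : (p.1 : ℂ) = m) :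
    p ∈ evenRegion ξ ↔ ∃ k : ℤ, m = p.2 + 2 * k := by
  simp only [evenRegion, Set.mem_ofPred_eq, hm]
  exact exists_congr fun k => by exact_mod_cast Iff.rfl

theorem mem_oddRegion_iff {p : paramSet ξ × ℤ} {m : ℤ} (hm : (p.1 : ℂ) = m) :
    p ∈ oddRegion ξ ↔ ∃ k : ℤ, m = p.2 + 1 + 2 * k := by
  simp only [oddRegion, Set.mem_ofPred_eq, hm]
  exact exists_congr fun k => by exact_mod_cast Iff.rfl

theorem mem_oddUp_iff {p : paramSet ξ × ℤ} {m : ℤ} (hm : (p.1 : ℂ) = m) :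
    p ∈ oddUp ξ ↔ p ∈ oddRegion ξ ∧ m + 1 ≤ p.2 := by
  simp only [oddUp, Set.mem_ofPred_eq, hm, Complex.intCast_re]
  exact and_congr_right fun _ => by exact_mod_cast Iff.rfl

theorem mem_oddRight_iff {p : paramSet ξ × ℤ} {m : ℤ} (hm : (p.1 : ℂ) = m) :
    p ∈ oddRight ξ ↔ p ∈ oddRegion ξ ∧ |p.2| + 1 ≤ m := by
  simp only [oddRight, Set.mem_ofPred_eq, hm, Complex.intCast_re]
  exact and_congr_right fun _ => by exact_mod_cast Iff.rfl

theorem mem_oddDown_iff {p : paramSet ξ × ℤ} {m : ℤ} (hm : (p.1 : ℂ) = m) :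
    p ∈ oddDown ξ ↔ p ∈ oddRegion ξ ∧ p.2 ≤ -m - 1 := by
  simp only [oddDown, Set.mem_ofPred_eq, hm, Complex.intCast_re]
  exact and_congr_right fun _ => by exact_mod_cast Iff.rfl

end Regions

end SL2Branching

end

open SL2Branching
theorem mainTheorem6
    -- a pair `G ⊃ G'` with complexified Lie algebras `(𝔰𝔩(2, ℂ), ℂ H)`, and `G'` connected
    (G : RealForm) (G' : ClosedSubgroup SL2C) (hle : G'.toSubgroup ≤ G.toSubgroup)
    (hconn : IsConnected (G'.toSubgroup : Set SL2C))
    (H X Y : M2) (htriple : IsTriple H X Y)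
    (hG' : Submodule.span ℂ (lieAlg G' : Set M2) = Submodule.span ℂ {H})
    -- a representation `Π` with nonsingular infinitesimal character `ξ`
    (ξ : ℂ) (hξ : ξ ≠ 0) (π : SmoothRep G) (hπ : HasInfChar G π.act ξ)
    -- a reduced coherent family passing through `Π`
    (P : paramSet ξ → SmoothRep G) (hP : IsReducedCoherentFamily π ξ P) :
    -- (1) `ξ ∉ ℤ`: the multiplicity is a function of the parity of `λ - ξ - ν ∈ ℤ`
    ((∀ n : ℤ, ξ ≠ n) →
      ∃ f : ZMod 2 → Cardinal, ∀ (l : paramSet ξ) (ν : ℤ), ∃ m : ℤ,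
        (l : ℂ) - ξ - ν = m ∧ sbMultiplicity G'.toSubgroup hle H (P l) ν = f m) ∧
    -- (2) `ξ ∈ ℕ₊`: decomposition of the parameter space and constancy on the four regions
    ((∃ n : ℕ, 0 < n ∧ ξ = n) →
      paramSet ξ = {l : ℂ | ∃ n : ℕ, 0 < n ∧ l = n} ∧
      evenRegion ξ ∪ oddRegion ξ = Set.univ ∧
      Disjoint (evenRegion ξ) (oddRegion ξ) ∧
      oddUp ξ ∪ oddRight ξ ∪ oddDown ξ = oddRegion ξ ∧
      Disjoint (oddUp ξ) (oddRight ξ) ∧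
      Disjoint (oddUp ξ) (oddDown ξ) ∧
      Disjoint (oddRight ξ) (oddDown ξ) ∧
      ∀ R ∈ ({evenRegion ξ, oddUp ξ, oddRight ξ, oddDown ξ} : Set (Set (paramSet ξ × ℤ))),
        ∃ c : Cardinal, ∀ p ∈ R, sbMultiplicity G'.toSubgroup hle H (P p.1) p.2 = c) := by
  refine ⟨fun hn => ?_, fun hn => ?_⟩
  · have hmem (a : ℤ) : ξ + a ∈ paramSet ξ := Or.inl ⟨hn, a, rfl⟩
    set M : ℤ → ℤ → Cardinal := fun a ν =>
      sbMultiplicity G'.toSubgroup hle H (P ⟨ξ + a, hmem a⟩) ν with hM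
    have hstep : ∀ d s : ℤ, (d = 1 ∨ d = -1) → (s = 1 ∨ s = -1) →
        ∀ l ν, M l ν = M (l + d) (ν + s) := by
      intro d s hd hs a ν
      refine sbMultiplicity_eq hconn htriple hG' hP hd hs (by push_cast; ring) ν fun h0 => ?_
      have hd2 : (d : ℂ) ^ 2 = 1 := by rcases hd with rfl | rfl <;> norm_num
      -- Solving `sν + d(ξ + a) + 1 = 0` for `ξ` would make it an integer.
      refine hn (-a - d * (s * ν + 1)) ?_
      push_cast
      simp only at h0
      linear_combination d * h0 - (ξ + a) * hd2
    refine ⟨fun z => M z.val 0, fun l ν => ?_⟩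
    obtain ⟨a, ha⟩ : ∃ a : ℤ, (l : ℂ) = ξ + a := by
      rcases l.2 with ⟨-, h⟩ | ⟨⟨m, -, h⟩, -⟩ | ⟨⟨m, -, h⟩, -⟩
      · exact h
      · exact absurd h (hn m)
      · exact absurd h (hn m)
    refine ⟨a - ν, by rw [ha]; push_cast; ring, ?_⟩
    obtain rfl : l = ⟨ξ + a, hmem a⟩ := Subtype.ext ha
    exact eq_of_parity_of_steps hstep a ν
  · have hmem (l : ℂ) := mem_paramSet_of_pos hn (l := l)
    have hint (l : paramSet ξ) : ∃ m : ℤ, 0 < m ∧ (l : ℂ) = m := (hmem l).1 l.2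
    refine ⟨?_, ?_, ?_, ?_, ?_, ?_, ?_, ?_⟩
    · ext l
      rw [hmem]
      constructor
      · rintro ⟨m, hm, rfl⟩
        exact ⟨m.toNat, by omega, by rw [← Int.cast_natCast, Int.toNat_of_nonneg hm.le]⟩
      · rintro ⟨m, hm, rfl⟩
        exact ⟨m, by omega, by simp⟩
    · refine Set.eq_univ_of_forall fun p => ?_
      obtain ⟨m, hm, h⟩ := hint p.1
      rw [Set.mem_union, mem_evenRegion_iff h, mem_oddRegion_iff h]
      rcases Int.even_or_odd' (m - p.2) with ⟨k, hk | hk⟩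
      · exact Or.inl ⟨k, by omega⟩
      · exact Or.inr ⟨k, by omega⟩
    · refine Set.disjoint_left.2 fun p => ?_
      obtain ⟨m, hm, h⟩ := hint p.1
      rw [mem_evenRegion_iff h, mem_oddRegion_iff h]
      rintro ⟨k, hk⟩ ⟨k', hk'⟩
      omega
    · ext p
      obtain ⟨m, hm, h⟩ := hint p.1
      rw [Set.mem_union, Set.mem_union, mem_oddUp_iff h, mem_oddRight_iff h, mem_oddDown_iff h,
        ← and_or_left, ← and_or_left, and_iff_left_iff_imp, mem_oddRegion_iff h]
      rintro ⟨k, hk⟩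
      rcases abs_cases p.2 with h1 | h1 <;> omega
    · refine Set.disjoint_left.2 fun p => ?_
      obtain ⟨m, hm, h⟩ := hint p.1
      rw [mem_oddUp_iff h, mem_oddRight_iff h]
      have := le_abs_self p.2
      omega
    · refine Set.disjoint_left.2 fun p => ?_
      obtain ⟨m, hm, h⟩ := hint p.1
      rw [mem_oddUp_iff h, mem_oddDown_iff h]
      omega
    · refine Set.disjoint_left.2 fun p => ?_
      obtain ⟨m, hm, h⟩ := hint p.1
      rw [mem_oddRight_iff h, mem_oddDown_iff h]
      have := neg_le_abs p.2
      omega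
    -- The value `0` for `a ≤ 0` is never used, as `IsStepInvariant` only concerns positive first
    -- arguments.
    · set M : ℤ → ℤ → Cardinal := fun a ν =>
        if h : 0 < a then
          sbMultiplicity G'.toSubgroup hle H (P ⟨a, (hmem a).2 ⟨a, h, rfl⟩⟩) ν else 0 with hM
      have hstep : IsStepInvariant M := by
        intro d s hd hs l ν h h' hne
        simp only [hM, dif_pos h, dif_pos h']
        exact sbMultiplicity_eq hconn htriple hG' hP hd hs (by push_cast; ring) ν (by
          have : ((s * ν + d * l + 1 : ℤ) : ℂ) ≠ 0 := Int.cast_ne_zero.2 hne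
          push_cast at this
          exact this)
      have hMp (p : paramSet ξ × ℤ) : ∃ n : ℕ, (p.1 : ℂ) = ((n + 1 : ℤ) : ℂ) ∧
          sbMultiplicity G'.toSubgroup hle H (P p.1) p.2 = M (n + 1) p.2 := by
        obtain ⟨m, hm, h⟩ := hint p.1
        obtain ⟨n, rfl⟩ : ∃ n : ℕ, m = n + 1 := ⟨(m - 1).toNat, by omega⟩
        refine ⟨n, h, ?_⟩
        simp only [hM, dif_pos hm]
        congr 2
        exact Subtype.ext h
      rintro R (rfl | rfl | rfl | rfl)
      -- Each constant is the multiplicity at a point of the region on the row `λ = 1`: `ν = 1, 2,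
      -- 0, -2` respectively.
      · refine ⟨M 1 1, fun p hp => ?_⟩
        obtain ⟨n, h, e⟩ := hMp p
        obtain ⟨k, hk⟩ := (mem_evenRegion_iff h).1 hp
        rw [e, hstep.eq_of_even n _ ⟨-k, by omega⟩]
      · refine ⟨M 1 2, fun p hp => ?_⟩
        obtain ⟨n, h, e⟩ := hMp p
        obtain ⟨hp, hle'⟩ := (mem_oddUp_iff h).1 hp
        obtain ⟨k, hk⟩ := (mem_oddRegion_iff h).1 hp
        rw [e, ← hstep.eq_of_up n (-k - 1).toNat]
        congr 1
        omega
      · refine ⟨M 1 0, fun p hp => ?_⟩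
        obtain ⟨n, h, e⟩ := hMp p
        obtain ⟨hp, hle'⟩ := (mem_oddRight_iff h).1 hp
        obtain ⟨k, hk⟩ := (mem_oddRegion_iff h).1 hp
        rw [e, hstep.eq_of_right n _ (by omega) ⟨-k, by omega⟩]
      · refine ⟨M 1 (-2), fun p hp => ?_⟩
        obtain ⟨n, h, e⟩ := hMp p
        obtain ⟨hp, hle'⟩ := (mem_oddDown_iff h).1 hp
        obtain ⟨k, hk⟩ := (mem_oddRegion_iff h).1 hp
        -- With `λ = n + 1` and `ν = n - 2k`, this index solves `-ν = n + 2 + 2(k - n - 1)`.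
        have := hstep.neg.eq_of_up n (k - n - 1).toNat
        rw [e, ← this]
        congr 1
        omega
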